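/- \textbf{Setting.} On $\mathbb Z^d$ let $|x-y|=\max_i|x_i-y_i|$ and $B_L(u)=\{x:|x-u|\le L\}$. Two balls $B_L(u),B_L(v)$ are called \emph{$L$-distant} if $|x-y|\ge L$ for all $x\in B_L(u)$, $y\in B_L(v)$. Let $V:\mathbb Z^d\times\Omega\to\mathbb R$ be a random field on a probability space $(\Omega,\mathcal F,\mathbb P)$; for $S\subset\mathbb Z^d$ let $\mathfrak F_S$ be the $\sigma$-algebra generated by $\{V(y;\cdot),\,y\in S\}$, and let $F_{V,x}(t\mid\mathfrak F_{\ne x})=\mathbb P\{V(x;\omega)\le t\mid\mathfrak F_{\mathbb Z^d\setminus\{x\}}\}$. Assume: (W2) there are $s>0$ and $C$ such that, for all $x\in\mathbb Z^d$, $a\in\mathbb R$ and $\epsilon\in[0,1]$, almost surely $F_{V,x}(a+\epsilon\mid\mathfrak F_{\ne x})-F_{V,x}(a\mid\mathfrak F_{\ne x})\le C\epsilon^{s}$; (W3) there is $C'$ such that, for all integers $L\ge1$, all $L$-distant balls $B_L(u),B_L(v)$ and all events $\mathcal E_u\in\mathfrak F_{B_L(u)}$, $\mathcal E_v\in\mathfrak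 F_{B_L(v)}$, one has $|\mathbb P(\mathcal E_u\cap\mathcal E_v)-\mathbb P(\mathcal E_u)\mathbb P(\mathcal E_v)|\le C'e^{-\ln^2L}$. Let $H(\omega)=-\Delta+gV(\cdot;\omega)$, where $\Delta$ is the nearest-neighbour lattice Laplacian, let $H_B$ be its restriction to a ball $B$ with Dirichlet boundary conditions, and let $G_B(x,y;E)$ be the kernel of $(H_B-E)^{-1}$. Put $\gamma(m,L)=m(1+L^{-1/8})$, fix $\beta\in(0,1)$, and let $\partial B_L(u)$ be the set of nearest-neighbour bonds joining $B_L(u)$ to its complement. The ball $B=B_L(u)$ is \emph{$m$-localized} if every normalized eigenfunction $\psi$ of $H_B$ satisfies $|\psi(x)||\psi(y)|\le e^{-\gamma(m,L)|x-y|}$ for all $x,y\in B$ with $|x-y|\ge L^{7/8}$; otherwise it is \emph{$m$-non-localized}. It is \emph{$(E,m)$-non-singular} if $E$ is not an eigenvalue of $H_B$ and $|\partial B|\,|G_B(x,y;E)|\le e^{-\gamma(m,L)|x-y|+2L^\beta}$ for all $x,y\in B$ with $|x-y|\ge L^{7/8}$; otherwise it is \emph{$(E,m)$-singular}. For an integer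 $L_0$, set $L_{k+1}=\lfloor L_k^{4/3}\rfloor+1$, $k\ge0$. \textbf{Theorem.} Assume (W2) and (W3). For any $m>0$, $p>0$ and any integer $L_0>2$ there exist $g_0<\infty$ and $b>0$ such that for any $g$ with $|g|\ge g_0$, all $k\ge0$ and any ball $B_{L_k}(u)\subset\mathbb Z^d$, $$\mathbb P\{B_{L_k}(u)\text{ is $m$-non-localized}\}\le L_k^{-p(1+b)^k}.$$ In the same range of parameters, for any $E\in\mathbb R$ and any pair of $L_k$-distant balls $B_{L_k}(u)$, $B_{L_k}(v)$, $$\mathbb P\{B_{L_k}(u)\text{ and }B_{L_k}(v)\text{ are both $(E,m)$-singular}\}\le L_k^{-p(1+b)^k}.$$ -/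

import Mathlib

namespace MixingAnderson

/-- The closed max-norm ball of integer radius `L` in the lattice `ℤ^d`, a finite cube. -/
noncomputable def ball {d : ℕ} (u : Fin d → ℤ) (L : ℕ) : Finset (Fin d → ℤ) :=
  Finset.Icc (fun i => u i - (L : ℤ)) (fun i => u i + (L : ℤ))

/-- `ball u L` is the ball for `dist`, the max-norm distance of `ℤ^d`. -/
theorem mem_ball {d : ℕ} {u x : Fin d → ℤ} {L : ℕ} :
    x ∈ ball u L ↔ dist x u ≤ (L : ℝ) := by
  rw [dist_pi_le_iff (Nat.cast_nonneg L), ball, Finset.mem_Icc, Pi.le_def, Pi.le_def,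
    ← forall_and]
  refine forall_congr' fun i => ?_
  rw [Int.dist_eq, abs_le]
  constructor
  · rintro ⟨h1, h2⟩
    have h1' : ((u i - (L : ℤ) : ℤ) : ℝ) ≤ (x i : ℝ) := by exact_mod_cast h1
    have h2' : (x i : ℝ) ≤ ((u i + (L : ℤ) : ℤ) : ℝ) := by exact_mod_cast h2
    push_cast at h1' h2'
    constructor <;> linarith
  · rintro ⟨h1, h2⟩
    constructor
    · have : ((u i - (L : ℤ) : ℤ) : ℝ) ≤ (x i : ℝ) := by push_cast; linarith
      exact_mod_cast this
    · have : (x i : ℝ) ≤ ((u i + (L : ℤ) : ℤ) : ℝ) := by push_cast; linarith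
      exact_mod_cast this

/-- The graph distance of `ℤ^d` with nearest-neighbour bonds (the `ℓ¹` distance). -/
def graphDist {d : ℕ} (x y : Fin d → ℤ) : ℤ := ∑ i, |x i - y i|

/-- Inner boundary of a ball: the points at max-norm distance exactly `L` from the centre. -/
def innerBoundary {d : ℕ} (u : Fin d → ℤ) (L : ℕ) : Set (Fin d → ℤ) :=
  {x | dist x u = (L : ℝ)}

/-- Outer boundary of a ball: the points outside, at graph distance `1` from the ball. -/
def outerBoundary {d : ℕ} (u : Fin d → ℤ) (L : ℕ) : Set (Fin d → ℤ) :=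
  {x | x ∉ ball u L ∧ ∃ z ∈ ball u L, graphDist x z = 1}

/-- Edge boundary of a ball: the bonds from the inner to the outer boundary. -/
def edgeBoundary {d : ℕ} (u : Fin d → ℤ) (L : ℕ) : Set ((Fin d → ℤ) × (Fin d → ℤ)) :=
  {e | e.1 ∈ innerBoundary u L ∧ e.2 ∈ outerBoundary u L ∧ graphDist e.1 e.2 = 1}

/-- The balls of radius `L` with centres `u`, `v` are `L`-distant:
their (max-norm) distance from each other is at least `L`. -/
def Distant {d : ℕ} (L : ℕ) (u v : Fin d → ℤ) : Prop :=
  ∀ x ∈ ball u L, ∀ y ∈ ball v L, (L : ℝ) ≤ dist x y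

/-- The kernel of the nearest-neighbour lattice Laplacian
`(Δ f) x = ∑ (f y - f x)`, the sum over the `2 d` neighbours `y` of `x`. -/
noncomputable def laplacianKernel {d : ℕ} (x y : Fin d → ℤ) : ℝ :=
  if x = y then -(2 * (d : ℝ)) else if graphDist x y = 1 then 1 else 0

/-- The operator `-Δ + g V` in a ball, with Dirichlet boundary conditions (that is, compressed to
the functions supported by the ball), for a fixed potential `W`. -/
noncomputable def hamiltonian {d : ℕ} (g : ℝ) (W : (Fin d → ℤ) → ℝ) (u : Fin d → ℤ) (L : ℕ) :
    Matrix (ball u L) (ball u L) ℂ :=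
  Matrix.of fun x y =>
    ((-laplacianKernel (x : Fin d → ℤ) (y : Fin d → ℤ) + if x = y then g * W x else 0 : ℝ) : ℂ)

/-- `H - E` for the ball Hamiltonian `H`. -/
noncomputable def shifted {d : ℕ} (g : ℝ) (W : (Fin d → ℤ) → ℝ) (u : Fin d → ℤ) (L : ℕ) (E : ℝ) :
    Matrix (ball u L) (ball u L) ℂ :=
  hamiltonian g W u L - (E : ℂ) • (1 : Matrix (ball u L) (ball u L) ℂ)

/-- The Green function `G(x, y; E)` in the ball, the kernel of `(H - E)⁻¹`;
meaningful when `E` is not an eigenvalue. -/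
noncomputable def green {d : ℕ} (g : ℝ) (W : (Fin d → ℤ) → ℝ) (u : Fin d → ℤ) (L : ℕ) (E : ℝ)
    (x y : ball u L) : ℂ :=
  (shifted g W u L E)⁻¹ x y

/-- The decay exponent `γ(m, L) = m (1 + L^{-1/8})`. -/
noncomputable def gam (m : ℝ) (L : ℕ) : ℝ := m * (1 + (L : ℝ) ^ (-(1 / 8 : ℝ)))

/-- The ball is `(E, m)`-non-singular (with the exponent `β` in the error term).
The resolvent has to exist: if `E` is an eigenvalue, the ball is singular. -/
def NonSingular {d : ℕ} (β g : ℝ) (W : (Fin d → ℤ) → ℝ) (E m : ℝ) (u : Fin d → ℤ) (L : ℕ) :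
    Prop :=
  IsUnit (shifted g W u L E) ∧
    ∀ x y : ball u L, (L : ℝ) ^ (7 / 8 : ℝ) ≤ dist (x : Fin d → ℤ) (y : Fin d → ℤ) →
      ((edgeBoundary u L).ncard : ℝ) * ‖green g W u L E x y‖ ≤
        Real.exp (-gam m L * dist (x : Fin d → ℤ) (y : Fin d → ℤ) + 2 * (L : ℝ) ^ β)

/-- The ball is `m`-localized: all normalized eigenfunctions of its Hamiltonian decay. -/
def Localized {d : ℕ} (g : ℝ) (W : (Fin d → ℤ) → ℝ) (m : ℝ) (u : Fin d → ℤ) (L : ℕ) : Prop :=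
  ∀ (E : ℝ) (ψ : ball u L → ℂ), (hamiltonian g W u L).mulVec ψ = (E : ℂ) • ψ →
    ∑ x, ‖ψ x‖ ^ 2 = 1 →
    ∀ x y : ball u L, (L : ℝ) ^ (7 / 8 : ℝ) ≤ dist (x : Fin d → ℤ) (y : Fin d → ℤ) →
      ‖ψ x‖ * ‖ψ y‖ ≤ Real.exp (-gam m L * dist (x : Fin d → ℤ) (y : Fin d → ℤ))

/-- The length scales `L_{k+1} = ⌊L_k ^ (4/3)⌋ + 1`. -/
noncomputable def scale (L₀ : ℕ) : ℕ → ℕ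
  | 0 => L₀
  | k + 1 => ⌊(scale L₀ k : ℝ) ^ (4 / 3 : ℝ)⌋₊ + 1

/-- The sigma-algebra generated by the values of the potential at the sites of `S`. -/
abbrev sigmaAlg {d : ℕ} {Ω : Type*} (V : (Fin d → ℤ) → Ω → ℝ) (S : Set (Fin d → ℤ)) :
    MeasurableSpace Ω :=
  ⨆ y ∈ S, MeasurableSpace.comap (V y) inferInstance

/-- The conditional distribution function `F_x(t | 𝔉_{≠x})` of `V x`, given the potential at all
the other sites. -/
noncomputable def condDistFun {d : ℕ} {Ω : Type*} [MeasurableSpace Ω]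
    (μ : MeasureTheory.Measure Ω) (V : (Fin d → ℤ) → Ω → ℝ) (x : Fin d → ℤ) (t : ℝ) : Ω → ℝ :=
  MeasureTheory.condExp (sigmaAlg V {x}ᶜ) μ
    (Set.indicator {ω | V x ω ≤ t} (fun _ => (1 : ℝ)))

/-- The conditional distribution functions are uniformly Hölder continuous. -/
def UniformlyHolder {d : ℕ} {Ω : Type*} [MeasurableSpace Ω]
    (μ : MeasureTheory.Measure Ω) (V : (Fin d → ℤ) → Ω → ℝ) : Prop :=
  ∃ C s : ℝ, 0 < s ∧ ∀ (x : Fin d → ℤ) (a ε : ℝ), 0 ≤ ε → ε ≤ 1 →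
    ∀ᵐ ω ∂μ, condDistFun μ V x (a + ε) ω - condDistFun μ V x a ω ≤ C * ε ^ s

/-- Rosenblatt strong mixing with rate `exp (-ln² L)` for `L`-distant balls of radius `L`. -/
def StronglyMixing {d : ℕ} {Ω : Type*} [MeasurableSpace Ω]
    (μ : MeasureTheory.Measure Ω) (V : (Fin d → ℤ) → Ω → ℝ) : Prop :=
  ∃ C : ℝ, ∀ L : ℕ, 1 ≤ L → ∀ u v : Fin d → ℤ, Distant L u v →
    ∀ A B : Set Ω, @MeasurableSet Ω (sigmaAlg V (ball u L : Set (Fin d → ℤ))) A →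
      @MeasurableSet Ω (sigmaAlg V (ball v L : Set (Fin d → ℤ))) B →
      |μ.real (A ∩ B) - μ.real A * μ.real B| ≤ C * Real.exp (-(Real.log (L : ℝ)) ^ 2)

end MixingAnderson

/-! ### Lattice geometry and Green functions of finite sets -/

namespace MixingAnderson

open Finset

variable {d : ℕ}

/-! The proof uses fractional moments at strong disorder in place of an induction over scales. Fix
`0 < τ < s`, `τ ≤ 1`. Hölder continuity of the conditional distribution of `V x` bounds the
conditional `τ`-th moment of `(g V x - b)⁻¹` by a multiple of `|g| ^ (-τ)`, for every `b` determined
by the other sites (`exists_lintegral_inv_rpow_le`). By the Schur complement formula, `G_S(x, y)` is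
such a factor times a sum of `G_{S \ x}(u, y)` over neighbours `u` of `x`, and these do not depend
on `V x`. Removing one site at a time gives exponential decay of the fractional moments at nonreal
energies, with a rate as large as desired when `|g|` is large, and also conditionally on events
outside `S` (`lintegral_greenExt_rpow_le`). Markov's inequality then yields decay in probability and
a Wegner estimate.

At a fixed real energy this suffices: the Wegner estimate keeps the energy away from the spectrum,
and the Green function passes from a nearby complex energy to the real one
(`norm_greenExt_real_le`).

Localization requires all eigenvalues at once. For points `x`, `y` at distance `R`, take disjoint
vicinities of radius `(R - 1) / 2`. With high probability they have no common almost-eigenvalue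
(`measure_pairResonant_le`), so an eigenvalue `E` avoids at least one of the two spectra. Moreover
`E` lies within a constant of the diagonal entry at a site outside a nonresonant vicinity. Given the
potential outside, only boundedly many points of a fine energy grid are thus relevant, and a union
bound gives decay inside (`measure_gridResonant_le`). The eigenfunction is then small at `x` or at
`y` (`norm_eigenfunction_le_or`).

All failure probabilities are exponentially small in a distance at least `L ^ (7/8)`, hence below
`exp (-p log² L)` after the losses are absorbed. Since `log L_k ≥ (4/3)^k`, this is the required
bound with `b = 1/3`. -/

/-- The max-norm distance of `ℤ^d` as a natural number. -/
def natDist (x y : Fin d → ℤ) : ℕ := Finset.univ.sup fun i => (x i - y i).natAbs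

theorem dist_eq_natDist (x y : Fin d → ℤ) : dist x y = (natDist x y : ℝ) := by
  apply le_antisymm
  · rw [dist_pi_le_iff (Nat.cast_nonneg _)]
    intro i
    have h : (x i - y i).natAbs ≤ natDist x y :=
      Finset.le_sup (f := fun i => (x i - y i).natAbs) (Finset.mem_univ i)
    rw [Int.dist_eq, ← Int.cast_sub, ← Int.cast_abs, Int.abs_eq_natAbs]
    exact_mod_cast h
  · have h : ∀ i, (((x i - y i).natAbs : ℕ) : ℝ) ≤ dist x y := fun i => by
      refine le_trans (le_of_eq ?_) (dist_le_pi_dist x y i)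
      rw [Int.dist_eq, ← Int.cast_sub, ← Int.cast_abs, Nat.cast_natAbs]
    have h2 : natDist x y ≤ ⌊dist x y⌋₊ :=
      Finset.sup_le fun i _ => Nat.le_floor (h i)
    exact (Nat.le_floor_iff dist_nonneg).1 h2

theorem natDist_comm (x y : Fin d → ℤ) : natDist x y = natDist y x := by
  have h := dist_comm x y
  rw [dist_eq_natDist, dist_eq_natDist] at h
  exact_mod_cast h

theorem natDist_triangle (x y z : Fin d → ℤ) : natDist x z ≤ natDist x y + natDist y z := by
  have h := dist_triangle x y z
  rw [dist_eq_natDist, dist_eq_natDist, dist_eq_natDist] at h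
  exact_mod_cast h

theorem natDist_self (x : Fin d → ℤ) : natDist x x = 0 := by
  have h := dist_self x
  rw [dist_eq_natDist] at h
  exact_mod_cast h

theorem mem_ball_iff_natDist {u x : Fin d → ℤ} {L : ℕ} : x ∈ ball u L ↔ natDist x u ≤ L := by
  rw [mem_ball, dist_eq_natDist, Nat.cast_le]

theorem card_ball (u : Fin d → ℤ) (L : ℕ) : (ball u L).card = (2 * L + 1) ^ d := by
  rw [ball, Pi.card_Icc]
  simp only [Int.card_Icc]
  rw [Finset.prod_congr rfl (g := fun _ => 2 * L + 1) (fun i _ => by omega)]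
  simp

theorem natDist_le_graphDist (x y : Fin d → ℤ) : (natDist x y : ℤ) ≤ graphDist x y := by
  have h0 : 0 ≤ graphDist x y := Finset.sum_nonneg fun i _ => abs_nonneg _
  obtain ⟨n, hn⟩ := Int.eq_ofNat_of_zero_le h0
  rw [hn]
  norm_cast
  refine Finset.sup_le fun i _ => ?_
  have h : |x i - y i| ≤ graphDist x y :=
    Finset.single_le_sum (f := fun i => |x i - y i|) (fun i _ => abs_nonneg _) (Finset.mem_univ i)
  rw [Int.abs_eq_natAbs] at h
  omega

theorem graphDist_comm (x y : Fin d → ℤ) : graphDist x y = graphDist y x :=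
  Finset.sum_congr rfl fun _ _ => abs_sub_comm _ _

/-- The off-diagonal part of the Hamiltonian, up to the sign. -/
def adj (x y : Fin d → ℤ) : ℝ := if graphDist x y = 1 then 1 else 0

theorem adj_comm (x y : Fin d → ℤ) : adj x y = adj y x := by
  rw [adj, adj, graphDist_comm]

theorem adj_self (x : Fin d → ℤ) : adj x x = 0 := by
  simp [adj, graphDist]

theorem adj_nonneg (x y : Fin d → ℤ) : 0 ≤ adj x y := by
  rw [adj]; split_ifs <;> norm_num

theorem natDist_le_one_of_adj {x y : Fin d → ℤ} (h : adj x y ≠ 0) : natDist x y ≤ 1 := by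
  have h1 : graphDist x y = 1 := by
    by_contra h2
    exact h (by rw [adj, if_neg h2])
  have h2 := natDist_le_graphDist x y
  omega

/-- All neighbours lie in the unit max-norm ball, which has `3 ^ d` points. The sharp count `2 d` is
not needed. -/
theorem sum_adj_le (S : Finset (Fin d → ℤ)) (x : Fin d → ℤ) : ∑ u ∈ S, adj x u ≤ 3 ^ d := by
  have h1 : ∑ u ∈ S, adj x u = ((S.filter fun u => graphDist x u = 1).card : ℝ) := by
    simp [adj, Finset.sum_boole]
  have h2 : (S.filter fun u => graphDist x u = 1) ⊆ ball x 1 := by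
    intro u hu
    rw [mem_ball_iff_natDist]
    have h3 := natDist_le_graphDist u x
    rw [graphDist_comm, (Finset.mem_filter.1 hu).2] at h3
    exact_mod_cast h3
  have h3 := Finset.card_le_card h2
  rw [card_ball] at h3
  rw [h1]
  exact_mod_cast h3

/-- The kernel of `-Δ + g w`. -/
noncomputable def ham (g : ℝ) (w : (Fin d → ℤ) → ℝ) (x y : Fin d → ℤ) : ℝ :=
  (if x = y then 2 * (d : ℝ) + g * w x else 0) - adj x y

theorem ham_eq (g : ℝ) (w : (Fin d → ℤ) → ℝ) (x y : Fin d → ℤ) :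
    ham g w x y = -laplacianKernel x y + if x = y then g * w x else 0 := by
  rw [ham, laplacianKernel]
  by_cases h : x = y
  · subst h
    simp [adj_self]
  · simp only [h, if_false, adj]
    split_ifs <;> simp

theorem ham_comm (g : ℝ) (w : (Fin d → ℤ) → ℝ) (x y : Fin d → ℤ) :
    ham g w x y = ham g w y x := by
  rw [ham, ham, adj_comm]
  by_cases h : x = y
  · subst h; rfl
  · rw [if_neg h, if_neg (Ne.symm h)]

/-- The action of `-Δ + g w`, restricted to a finite set with Dirichlet boundary conditions. -/
noncomputable def hamApply (g : ℝ) (w : (Fin d → ℤ) → ℝ) (S : Finset (Fin d → ℤ))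
    (f : (Fin d → ℤ) → ℂ) (x : Fin d → ℤ) : ℂ := ∑ u ∈ S, (ham g w x u : ℂ) * f u

theorem hamApply_eq (g : ℝ) (w : (Fin d → ℤ) → ℝ) {S : Finset (Fin d → ℤ)}
    (f : (Fin d → ℤ) → ℂ) {x : Fin d → ℤ} (hx : x ∈ S) :
    hamApply g w S f x =
      ((g * w x + 2 * d : ℝ) : ℂ) * f x - ∑ u ∈ S, (adj x u : ℂ) * f u := by
  rw [hamApply]
  simp only [ham, Complex.ofReal_sub, sub_mul, Finset.sum_sub_distrib]
  congr 1
  rw [Finset.sum_eq_single x]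
  · rw [if_pos rfl, add_comm]
  · intro b _ hb
    rw [if_neg (Ne.symm hb)]; simp
  · exact fun h => absurd hx h

/-- The Hamiltonian of a finite set. -/
noncomputable def hamMatrix (g : ℝ) (w : (Fin d → ℤ) → ℝ) (S : Finset (Fin d → ℤ)) :
    Matrix S S ℂ := Matrix.of fun x y => (ham g w x y : ℂ)

theorem hamiltonian_eq (g : ℝ) (w : (Fin d → ℤ) → ℝ) (u : Fin d → ℤ) (L : ℕ) :
    hamiltonian g w u L = hamMatrix g w (ball u L) := by
  ext x y
  simp only [hamiltonian, hamMatrix, Matrix.of_apply, ham_eq, Subtype.ext_iff]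

theorem hamMatrix_isHermitian (g : ℝ) (w : (Fin d → ℤ) → ℝ) (S : Finset (Fin d → ℤ)) :
    (hamMatrix g w S).IsHermitian := by
  ext x y
  simp [hamMatrix, Matrix.conjTranspose_apply, ham_comm g w (y : Fin d → ℤ)]

theorem hamMatrix_mulVec (g : ℝ) (w : (Fin d → ℤ) → ℝ) (S : Finset (Fin d → ℤ))
    (f : (Fin d → ℤ) → ℂ) (x : S) :
    (hamMatrix g w S).mulVec (fun y => f y) x = hamApply g w S f x := by
  rw [Matrix.mulVec, dotProduct, hamApply, ← Finset.sum_coe_sort S]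
  rfl

theorem isUnit_det_hamMatrix_sub {g : ℝ} {w : (Fin d → ℤ) → ℝ} {S : Finset (Fin d → ℤ)} {z : ℂ}
    (h : ∀ i, ((hamMatrix_isHermitian g w S).eigenvalues i : ℂ) ≠ z) :
    IsUnit (hamMatrix g w S - z • (1 : Matrix S S ℂ)).det := by
  rw [isUnit_iff_ne_zero]
  have h1 := (hamMatrix_isHermitian g w S).charpoly_eq
  have h2 := congrArg (Polynomial.eval z) h1
  rw [Matrix.eval_charpoly, Polynomial.eval_prod] at h2
  have h3 : (hamMatrix g w S - z • (1 : Matrix S S ℂ)) =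
      -(Matrix.scalar S z - hamMatrix g w S) := by
    rw [neg_sub, Matrix.scalar_apply, Matrix.smul_one_eq_diagonal]
  rw [h3, Matrix.det_neg, h2]
  refine mul_ne_zero (pow_ne_zero _ (by norm_num)) (Finset.prod_ne_zero_iff.2 fun i _ => ?_)
  simp only [Polynomial.eval_sub, Polynomial.eval_X, Polynomial.eval_C]
  exact sub_ne_zero.2 (h i).symm

theorem isUnit_det_hamMatrix_sub_of_im_ne (g : ℝ) (w : (Fin d → ℤ) → ℝ)
    (S : Finset (Fin d → ℤ)) {z : ℂ} (hz : z.im ≠ 0) :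
    IsUnit (hamMatrix g w S - z • (1 : Matrix S S ℂ)).det :=
  isUnit_det_hamMatrix_sub fun i h => hz (by rw [← h]; exact Complex.ofReal_im _)

/-- The Green function of a finite set, extended by zero. -/
noncomputable def greenExt (g : ℝ) (z : ℂ) (S : Finset (Fin d → ℤ)) (w : (Fin d → ℤ) → ℝ)
    (x y : Fin d → ℤ) : ℂ :=
  if h : x ∈ S ∧ y ∈ S then (hamMatrix g w S - z • (1 : Matrix S S ℂ))⁻¹ ⟨x, h.1⟩ ⟨y, h.2⟩ else 0

theorem sub_mulVec (g : ℝ) (w : (Fin d → ℤ) → ℝ) (S : Finset (Fin d → ℤ)) (z : ℂ)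
    (f : (Fin d → ℤ) → ℂ) (x : S) :
    (hamMatrix g w S - z • (1 : Matrix S S ℂ)).mulVec (fun y => f y) x =
      hamApply g w S f x - z * f x := by
  rw [Matrix.sub_mulVec, Pi.sub_apply, hamMatrix_mulVec, Matrix.smul_mulVec, Matrix.one_mulVec]
  rfl

/-- This is the form in which resolvent identities are used: a change of domain or of energy is put
into the source `ρ`. -/
theorem eq_sum_greenExt_of_isUnit {g : ℝ} {w : (Fin d → ℤ) → ℝ} {S : Finset (Fin d → ℤ)} {z : ℂ}
    (hz : IsUnit (hamMatrix g w S - z • (1 : Matrix S S ℂ)).det) {f ρ : (Fin d → ℤ) → ℂ}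
    (h : ∀ x ∈ S, hamApply g w S f x - z * f x = ρ x) {x : Fin d → ℤ} (hx : x ∈ S) :
    f x = ∑ y ∈ S, greenExt g z S w x y * ρ y := by
  set M := hamMatrix g w S - z • (1 : Matrix S S ℂ) with hM
  have h1 : M.mulVec (fun y : S => f y) = fun y : S => ρ y := by
    funext y
    rw [hM, sub_mulVec, h y y.2]
  have h2 : (fun y : S => f y) = M⁻¹.mulVec (fun y : S => ρ y) := by
    rw [← h1, Matrix.mulVec_mulVec, Matrix.nonsing_inv_mul _ hz, Matrix.one_mulVec]
  have h3 := congrFun h2 ⟨x, hx⟩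
  rw [Matrix.mulVec, dotProduct] at h3
  simp only at h3
  rw [h3, ← Finset.sum_coe_sort S]
  refine Finset.sum_congr rfl fun y _ => ?_
  rw [greenExt, dif_pos ⟨hx, y.2⟩]

theorem eq_sum_greenExt {g : ℝ} {w : (Fin d → ℤ) → ℝ} {S : Finset (Fin d → ℤ)} {z : ℂ}
    (hz : z.im ≠ 0) {f ρ : (Fin d → ℤ) → ℂ}
    (h : ∀ x ∈ S, hamApply g w S f x - z * f x = ρ x) {x : Fin d → ℤ} (hx : x ∈ S) :
    f x = ∑ y ∈ S, greenExt g z S w x y * ρ y :=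
  eq_sum_greenExt_of_isUnit (isUnit_det_hamMatrix_sub_of_im_ne g w S hz) h hx

theorem hamApply_greenExt_of_isUnit {g : ℝ} {w : (Fin d → ℤ) → ℝ} {S : Finset (Fin d → ℤ)} {z : ℂ}
    (hz : IsUnit (hamMatrix g w S - z • (1 : Matrix S S ℂ)).det) {x y : Fin d → ℤ}
    (hx : x ∈ S) (hy : y ∈ S) :
    hamApply g w S (fun u => greenExt g z S w u y) x - z * greenExt g z S w x y =
      if x = y then 1 else 0 := by
  have h1 := sub_mulVec g w S z (fun u => greenExt g z S w u y) ⟨x, hx⟩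
  set M := hamMatrix g w S - z • (1 : Matrix S S ℂ) with hM
  rw [← h1]
  have h2 : (fun u : S => greenExt g z S w u y) = fun u : S => M⁻¹ u ⟨y, hy⟩ := by
    funext u
    rw [greenExt, dif_pos ⟨u.2, hy⟩]
  have h3 := congrFun (congrFun (Matrix.mul_nonsing_inv M hz) ⟨x, hx⟩) ⟨y, hy⟩
  rw [Matrix.mul_apply, Matrix.one_apply] at h3
  rw [Matrix.mulVec, dotProduct]
  simp only [Subtype.mk.injEq] at h3
  rw [← h3]
  exact Finset.sum_congr rfl fun u _ => congrArg _ (congrFun h2 u)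

theorem hamApply_greenExt {g : ℝ} {w : (Fin d → ℤ) → ℝ} {S : Finset (Fin d → ℤ)} {z : ℂ}
    (hz : z.im ≠ 0) {x y : Fin d → ℤ} (hx : x ∈ S) (hy : y ∈ S) :
    hamApply g w S (fun u => greenExt g z S w u y) x - z * greenExt g z S w x y =
      if x = y then 1 else 0 :=
  hamApply_greenExt_of_isUnit (isUnit_det_hamMatrix_sub_of_im_ne g w S hz) hx hy

theorem continuous_hamMatrix (g : ℝ) (S : Finset (Fin d → ℤ)) :
    Continuous fun w : (Fin d → ℤ) → ℝ => hamMatrix g w S := by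
  refine continuous_matrix fun x y => ?_
  simp only [hamMatrix, Matrix.of_apply, ham]
  refine Complex.continuous_ofReal.comp ?_
  by_cases h : (x : Fin d → ℤ) = y
  · simp only [h, if_true]; fun_prop
  · simp only [h, if_false]; fun_prop

/-- Cramer's rule, with a determinant that never vanishes because `z` is not real. Working off the
real axis makes measurability in the potential immediate. -/
theorem continuous_greenExt (g : ℝ) {z : ℂ} (hz : z.im ≠ 0) (S : Finset (Fin d → ℤ))
    (x y : Fin d → ℤ) : Continuous fun w => greenExt g z S w x y := by
  unfold greenExt
  by_cases h : x ∈ S ∧ y ∈ S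
  · simp only [h, and_self, dif_pos, Matrix.inv_def, Matrix.smul_apply, smul_eq_mul,
      Ring.inverse_eq_inv]
    have hc : Continuous fun w : (Fin d → ℤ) → ℝ => hamMatrix g w S - z • (1 : Matrix S S ℂ) :=
      (continuous_hamMatrix g S).sub continuous_const
    exact (hc.matrix_det.inv₀ fun w => (isUnit_det_hamMatrix_sub_of_im_ne g w S hz).ne_zero).mul
      (hc.matrix_adjugate.matrix_elem _ _)
  · simp only [h, dif_neg, not_false_eq_true]
    exact continuous_const

theorem ham_update_of_ne {g : ℝ} {w : (Fin d → ℤ) → ℝ} {x a : Fin d → ℤ} (h : x ≠ a) (t : ℝ)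
    (y : Fin d → ℤ) : ham g (Function.update w a t) x y = ham g w x y := by
  rw [ham, ham, Function.update_of_ne h]

theorem greenExt_update {g : ℝ} {z : ℂ} {S : Finset (Fin d → ℤ)} {a : Fin d → ℤ} (ha : a ∉ S)
    (w : (Fin d → ℤ) → ℝ) (t : ℝ) (x y : Fin d → ℤ) :
    greenExt g z S (Function.update w a t) x y = greenExt g z S w x y := by
  have h : hamMatrix g (Function.update w a t) S = hamMatrix g w S := by
    ext u v
    simp only [hamMatrix, Matrix.of_apply]
    rw [ham_update_of_ne]
    rintro rfl
    exact ha u.2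
  rw [greenExt, greenExt, h]

theorem hamApply_update {g : ℝ} {w : (Fin d → ℤ) → ℝ} {x a : Fin d → ℤ} (h : x ≠ a) (t : ℝ)
    (S : Finset (Fin d → ℤ)) (f : (Fin d → ℤ) → ℂ) :
    hamApply g (Function.update w a t) S f x = hamApply g w S f x := by
  simp only [hamApply, ham_update_of_ne h]

/-! ### Schur complement at a site -/

/-- The self-energy of the site `x`: the Schur complement formula reads
`G(x, x) = (g w x - selfEnergy)⁻¹`. -/
noncomputable def selfEnergy (g : ℝ) (z : ℂ) (S : Finset (Fin d → ℤ)) (w : (Fin d → ℤ) → ℝ)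
    (x : Fin d → ℤ) : ℂ :=
  z - 2 * d + ∑ u ∈ S.erase x, (adj x u : ℂ) *
    ∑ v ∈ S.erase x, greenExt g z (S.erase x) w u v * (adj x v : ℂ)

/-- On `S.erase x` the column `G_S(·, y)` solves an equation whose source contains its value at `x`.
Solving it with the Green function of `S.erase x` and inserting the result into the equation at `x`
leaves a scalar equation for `G_S(x, y)`. -/
theorem schur_greenExt {g : ℝ} {z : ℂ} (hz : z.im ≠ 0) {S : Finset (Fin d → ℤ)}
    (w : (Fin d → ℤ) → ℝ) {x y : Fin d → ℤ} (hx : x ∈ S) (hy : y ∈ S) :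
    ((g * w x : ℝ) - selfEnergy g z S w x) * greenExt g z S w x y =
      if x = y then 1 else ∑ u ∈ S.erase x, (adj x u : ℂ) * greenExt g z (S.erase x) w u y := by
  set φ : (Fin d → ℤ) → ℂ := fun u => greenExt g z S w u y with hφ
  have hsplit : ∀ u ∈ S.erase x, hamApply g w S φ u =
      hamApply g w (S.erase x) φ u - (adj x u : ℂ) * φ x := by
    intro u hu
    rw [hamApply, ← Finset.sum_erase_add _ _ hx, hamApply, ham, if_neg (Finset.ne_of_mem_erase hu),
      adj_comm u x]
    push_cast
    ring
  have h1 : ∀ u ∈ S.erase x, φ u = ∑ v ∈ S.erase x, greenExt g z (S.erase x) w u v *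
      ((if v = y then 1 else 0) + (adj x v : ℂ) * φ x) := by
    intro u hu
    refine eq_sum_greenExt hz (f := φ)
      (ρ := fun v => (if v = y then 1 else 0) + (adj x v : ℂ) * φ x) (fun v hv => ?_) hu
    have h2 := hamApply_greenExt (g := g) (w := w) hz (Finset.mem_of_mem_erase hv) hy
    rw [hsplit v hv] at h2
    rw [← h2]
    ring
  have h2 := hamApply_greenExt (g := g) (w := w) hz hx hy
  rw [hamApply_eq _ _ _ hx, ← Finset.sum_erase_add _ _ hx, adj_self] at h2
  have h3 : ∑ u ∈ S.erase x, (adj x u : ℂ) * φ u =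
      ∑ u ∈ S.erase x, (adj x u : ℂ) * (∑ v ∈ S.erase x, greenExt g z (S.erase x) w u v *
        (if v = y then 1 else 0)) +
      (∑ u ∈ S.erase x, (adj x u : ℂ) *
        ∑ v ∈ S.erase x, greenExt g z (S.erase x) w u v * (adj x v : ℂ)) * φ x := by
    rw [Finset.sum_mul, ← Finset.sum_add_distrib]
    refine Finset.sum_congr rfl fun u hu => ?_
    rw [h1 u hu, mul_assoc, ← mul_add, Finset.sum_mul, ← Finset.sum_add_distrib]
    congr 1
    exact Finset.sum_congr rfl fun v _ => by ring
  have h4 : (if x = y then (1 : ℂ) else 0) + ∑ u ∈ S.erase x, (adj x u : ℂ) *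
      (∑ v ∈ S.erase x, greenExt g z (S.erase x) w u v * (if v = y then 1 else 0)) =
      if x = y then 1 else ∑ u ∈ S.erase x, (adj x u : ℂ) * greenExt g z (S.erase x) w u y := by
    by_cases hxy : x = y
    · rw [if_pos hxy, if_pos hxy, Finset.sum_eq_zero, add_zero]
      intro u _
      rw [Finset.sum_eq_zero, mul_zero]
      intro v hv
      rw [if_neg, mul_zero]
      rw [← hxy]
      exact Finset.ne_of_mem_erase hv
    · rw [if_neg hxy, if_neg hxy, zero_add]
      refine Finset.sum_congr rfl fun u _ => ?_
      congr 1
      simp only [mul_ite, mul_one, mul_zero]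
      rw [Finset.sum_ite_eq' (S.erase x) y, if_pos]
      exact Finset.mem_erase.2 ⟨Ne.symm hxy, hy⟩
  rw [← h4, ← h2, selfEnergy]
  change (_ : ℂ) * φ x = ((_ : ℂ) * φ x - (∑ u ∈ S.erase x, (adj x u : ℂ) * φ u + _) - z * φ x) + _
  rw [h3]
  push_cast
  ring

theorem selfEnergy_update (g : ℝ) (z : ℂ) (S : Finset (Fin d → ℤ)) (w : (Fin d → ℤ) → ℝ)
    (x : Fin d → ℤ) (t : ℝ) :
    selfEnergy g z S (Function.update w x t) x = selfEnergy g z S w x := by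
  simp only [selfEnergy, greenExt_update (Finset.notMem_erase x S)]

theorem continuous_selfEnergy (g : ℝ) {z : ℂ} (hz : z.im ≠ 0) (S : Finset (Fin d → ℤ))
    (x : Fin d → ℤ) : Continuous fun w => selfEnergy g z S w x := by
  unfold selfEnergy
  refine continuous_const.add (continuous_finsetSum _ fun u _ => continuous_const.mul
    (continuous_finsetSum _ fun v _ => (continuous_greenExt g hz _ u v).mul continuous_const))

end MixingAnderson

/-! ### Conditional fractional moments at one site -/

namespace MixingAnderson

open MeasureTheory
open scoped ENNReal

variable {d : ℕ} {Ω : Type*} [MeasurableSpace Ω]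

/-- The conditional distribution functions are Hölder continuous with explicit constants. -/
def HolderWith (μ : Measure Ω) (V : (Fin d → ℤ) → Ω → ℝ) (C s : ℝ) : Prop :=
  ∀ (x : Fin d → ℤ) (a ε : ℝ), 0 ≤ ε → ε ≤ 1 →
    ∀ᵐ ω ∂μ, condDistFun μ V x (a + ε) ω - condDistFun μ V x a ω ≤ C * ε ^ s

theorem sigmaAlg_le {V : (Fin d → ℤ) → Ω → ℝ} (hV : ∀ x, Measurable (V x))
    (S : Set (Fin d → ℤ)) : sigmaAlg V S ≤ (inferInstance : MeasurableSpace Ω) :=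
  iSup₂_le fun y _ => (hV y).comap_le

section Holder

variable {μ : Measure Ω} [IsProbabilityMeasure μ] {V : (Fin d → ℤ) → Ω → ℝ} {C s : ℝ}

theorem measure_inter_Ioc_le (hV : ∀ x, Measurable (V x)) (hH : HolderWith μ V C s)
    (x : Fin d → ℤ) (a : ℝ) {ε : ℝ} (hε0 : 0 ≤ ε) (hε1 : ε ≤ 1) {B : Set Ω}
    (hB : MeasurableSet[sigmaAlg V {x}ᶜ] B) :
    μ (B ∩ V x ⁻¹' Set.Ioc a (a + ε)) ≤ ENNReal.ofReal (C * ε ^ s) * μ B := by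
  have hm := sigmaAlg_le hV ({x}ᶜ : Set (Fin d → ℤ))
  have hB' : MeasurableSet B := hm B hB
  have hmeas : ∀ t : ℝ, MeasurableSet {ω | V x ω ≤ t} := fun t => hV x measurableSet_Iic
  have hint : ∀ t : ℝ, Integrable (Set.indicator {ω | V x ω ≤ t} (fun _ => (1 : ℝ))) μ :=
    fun t => (integrable_const (1 : ℝ)).indicator (hmeas t)
  have hset : ∀ t : ℝ, ∫ ω in B, condDistFun μ V x t ω ∂μ = μ.real (B ∩ {ω | V x ω ≤ t}) := by
    intro t
    rw [condDistFun, setIntegral_condExp hm (hint t) hB, integral_indicator (hmeas t),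
      Measure.restrict_restrict (hmeas t), setIntegral_const, smul_eq_mul, mul_one, Set.inter_comm]
  have h1 : ∫ ω in B, (condDistFun μ V x (a + ε) ω - condDistFun μ V x a ω) ∂μ ≤
      ∫ _ in B, C * ε ^ s ∂μ := by
    refine setIntegral_mono_ae ?_ (integrable_const _).integrableOn (hH x a ε hε0 hε1)
    exact (integrable_condExp.sub integrable_condExp).integrableOn
  have hci : ∀ t, Integrable (condDistFun μ V x t) μ := fun t => integrable_condExp
  rw [integral_sub (hci _).integrableOn (hci _).integrableOn, hset, hset,
    setIntegral_const, smul_eq_mul] at h1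
  have h2 : μ.real (B ∩ V x ⁻¹' Set.Ioc a (a + ε)) =
      μ.real (B ∩ {ω | V x ω ≤ a + ε}) - μ.real (B ∩ {ω | V x ω ≤ a}) := by
    rw [← measureReal_sdiff _ (hB'.inter (hmeas a))]
    · congr 1
      ext ω
      simp only [Set.mem_inter_iff, Set.mem_preimage, Set.mem_Ioc, Set.mem_sdiff, Set.mem_ofPred_eq]
      constructor
      · rintro ⟨h, h', h''⟩
        exact ⟨⟨h, h''⟩, fun h3 => absurd h3.2 (not_le.2 h')⟩
      · rintro ⟨⟨h, h'⟩, h''⟩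
        exact ⟨h, not_le.1 fun h3 => h'' ⟨h, h3⟩, h'⟩
    · rintro ω ⟨h, h'⟩
      exact ⟨h, le_trans (show V x ω ≤ a from h') (by linarith)⟩
  rw [← h2] at h1
  rw [← ofReal_measureReal, ← ofReal_measureReal (μ := μ) (s := B),
    ← ENNReal.ofReal_mul' measureReal_nonneg]
  exact ENNReal.ofReal_le_ofReal (by linarith)

/-- The bound for events is an inequality between two measures on the sigma-algebra of the other
sites, so it passes to integrals of functions measurable there. -/
theorem setLIntegral_Ioc_le (hV : ∀ x, Measurable (V x)) (hH : HolderWith μ V C s)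
    (x : Fin d → ℤ) (a : ℝ) {ε : ℝ} (hε0 : 0 ≤ ε) (hε1 : ε ≤ 1) {Ψ : Ω → ℝ≥0∞}
    (hΨ : Measurable[sigmaAlg V {x}ᶜ] Ψ) :
    ∫⁻ ω in V x ⁻¹' Set.Ioc a (a + ε), Ψ ω ∂μ ≤ ENNReal.ofReal (C * ε ^ s) * ∫⁻ ω, Ψ ω ∂μ := by
  have hm := sigmaAlg_le hV ({x}ᶜ : Set (Fin d → ℤ))
  rw [← lintegral_trim hm hΨ, ← lintegral_trim hm hΨ, ← smul_eq_mul, ← lintegral_smul_measure]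
  refine lintegral_mono' ?_ le_rfl
  refine Measure.le_iff.2 fun B hB => ?_
  rw [trim_measurableSet_eq hm hB, Measure.restrict_apply (hm B hB), Measure.smul_apply,
    trim_measurableSet_eq hm hB]
  exact measure_inter_Ioc_le hV hH x a hε0 hε1 hB

/-- The Hölder bound holds almost surely for each fixed endpoint, so a random centre cannot be
inserted directly. The centre is first rounded to the grid `ε ℤ`, and `Ψ` is split according to the
countably many cells. -/
theorem setLIntegral_abs_sub_le (hV : ∀ x, Measurable (V x)) (hH : HolderWith μ V C s)
    (x : Fin d → ℤ) {ε : ℝ} (hε0 : 0 < ε) (hε1 : ε ≤ 1) {Ψ : Ω → ℝ≥0∞} {b : Ω → ℝ}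
    (hΨ : Measurable[sigmaAlg V {x}ᶜ] Ψ) (hb : Measurable[sigmaAlg V {x}ᶜ] b) :
    ∫⁻ ω in {ω | |V x ω - b ω| ≤ ε}, Ψ ω ∂μ ≤
      4 * ENNReal.ofReal (C * ε ^ s) * ∫⁻ ω, Ψ ω ∂μ := by
  have hm := sigmaAlg_le hV ({x}ᶜ : Set (Fin d → ℤ))
  have hΨ' : Measurable Ψ := hΨ.mono hm le_rfl
  have hb' : Measurable b := hb.mono hm le_rfl
  set P : ℤ → Ω → ℝ≥0∞ := fun j => Set.indicator {ω | ⌊b ω / ε⌋ = j} Ψ with hP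
  have hfl : ∀ j : ℤ, MeasurableSet[sigmaAlg V {x}ᶜ] {ω | ⌊b ω / ε⌋ = j} := fun j =>
    (Int.measurable_floor.comp (hb.div_const ε)) (measurableSet_singleton j)
  have hPm : ∀ j, Measurable[sigmaAlg V {x}ᶜ] (P j) := fun j => hΨ.indicator (hfl j)
  have hPm' : ∀ j, Measurable (P j) := fun j => (hPm j).mono hm le_rfl
  -- If `b ∈ [jε, (j+1)ε)` and `|V x - b| ≤ ε`, then `V x ∈ [(j-1)ε, (j+2)ε)`. The left endpoint is
  -- included while the cells are open on the left, hence four cells and not three.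
  set I : ℤ → Fin 4 → Set Ω := fun j i =>
    V x ⁻¹' Set.Ioc ((j - 2 + (i : ℕ)) * ε) ((j - 2 + (i : ℕ)) * ε + ε) with hI
  have hIm : ∀ j i, MeasurableSet (I j i) := fun j i => hV x measurableSet_Ioc
  have hDm : MeasurableSet {ω | |V x ω - b ω| ≤ ε} :=
    measurableSet_le ((hV x).sub hb').abs measurable_const
  have hpt : ∀ ω, Set.indicator {ω | |V x ω - b ω| ≤ ε} Ψ ω ≤
      ∑' j, ∑ i, (I j i).indicator (P j) ω := by
    intro ω
    by_cases hω : |V x ω - b ω| ≤ ε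
    · rw [Set.indicator_of_mem (by exact hω)]
      set j := ⌊b ω / ε⌋ with hj
      have hj1 : (j : ℝ) * ε ≤ b ω := (le_div_iff₀ hε0).1 (Int.floor_le _)
      have hj2 : b ω < (j + 1) * ε := (div_lt_iff₀ hε0).1 (Int.lt_floor_add_one _)
      set k := ⌈V x ω / ε⌉ with hk
      have hk1 : V x ω ≤ k * ε := (div_le_iff₀ hε0).1 (Int.le_ceil _)
      have hk2 : ((k : ℝ) - 1) * ε < V x ω := by
        rw [← lt_div_iff₀ hε0]; linarith [Int.ceil_lt_add_one (V x ω / ε)]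
      rw [abs_le] at hω
      have hk3 : j - 1 ≤ k := by
        have h : ((j : ℝ) - 1) * ε ≤ k * ε := by nlinarith
        have h' := le_of_mul_le_mul_right h hε0
        exact_mod_cast h'
      have hk4 : k < j + 3 := by
        have h : ((k : ℝ) - 1) * ε < (j + 2) * ε := by nlinarith
        have h' := lt_of_mul_lt_mul_right h hε0.le
        have h'' : (k : ℝ) < j + 3 := by linarith
        exact_mod_cast h''
      obtain ⟨n, hn⟩ := Int.eq_ofNat_of_zero_le (show 0 ≤ k - 1 - (j - 2) by omega)
      have hn4 : n < 4 := by omega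
      refine le_trans ?_ (ENNReal.le_tsum j)
      refine le_trans ?_ (Finset.single_le_sum (fun i _ => zero_le) (Finset.mem_univ ⟨n, hn4⟩))
      have hn' : (j : ℝ) - 2 + n = k - 1 := by
        have h : (n : ℤ) = k - 1 - (j - 2) := by omega
        have h' : ((n : ℤ) : ℝ) = ((k - 1 - (j - 2) : ℤ) : ℝ) := by rw [h]
        push_cast at h'
        linarith
      rw [Set.indicator_of_mem, hP]
      · simp only
        rw [Set.indicator_of_mem (by exact hj.symm)]
      · simp only [hI, Set.mem_preimage, Set.mem_Ioc, hn']
        exact ⟨hk2, by linarith⟩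
    · rw [Set.indicator_of_notMem (by exact hω)]
      exact zero_le
  calc ∫⁻ ω in {ω | |V x ω - b ω| ≤ ε}, Ψ ω ∂μ
      = ∫⁻ ω, Set.indicator {ω | |V x ω - b ω| ≤ ε} Ψ ω ∂μ := (lintegral_indicator hDm Ψ).symm
    _ ≤ ∫⁻ ω, ∑' j, ∑ i, (I j i).indicator (P j) ω ∂μ := lintegral_mono hpt
    _ = ∑' j, ∑ i, ∫⁻ ω in I j i, P j ω ∂μ := by
        rw [lintegral_tsum fun j => (Finset.measurable_fun_sum _ fun i _ =>
          (hPm' j).indicator (hIm j i)).aemeasurable]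
        refine tsum_congr fun j => ?_
        rw [lintegral_finsetSum _ fun i _ => (hPm' j).indicator (hIm j i)]
        exact Finset.sum_congr rfl fun i _ => lintegral_indicator (hIm j i) _
    _ ≤ ∑' j, ∑ _i : Fin 4, ENNReal.ofReal (C * ε ^ s) * ∫⁻ ω, P j ω ∂μ :=
        ENNReal.tsum_le_tsum fun j => Finset.sum_le_sum fun i _ =>
          setLIntegral_Ioc_le hV hH x _ hε0.le hε1 (hPm j)
    _ = 4 * ENNReal.ofReal (C * ε ^ s) * ∑' j, ∫⁻ ω, P j ω ∂μ := by
        rw [← ENNReal.tsum_mul_left]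
        refine tsum_congr fun j => ?_
        simp [mul_assoc]
    _ = 4 * ENNReal.ofReal (C * ε ^ s) * ∫⁻ ω, Ψ ω ∂μ := by
        rw [← lintegral_tsum fun j => (hPm' j).aemeasurable]
        congr 2
        funext ω
        rw [tsum_eq_single ⌊b ω / ε⌋]
        · rw [hP]; simp only; rw [Set.indicator_of_mem (by rfl)]
        · intro j hj
          rw [hP]; simp only; rw [Set.indicator_of_notMem (by exact hj.symm)]

/-- Dyadic decomposition in `t = |g V x - b| / |g|`. Where `t` is about `2 ^ (-n)`, the integrand is
at most of order `|g| ^ (-τ) * 2 ^ (n τ)`, while the conditional probability is of order `2 ^ (-n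
s)`. The series converges since `τ < s`. Only the real part of `b` matters for the location of `V
x`. -/
theorem exists_lintegral_inv_rpow_le (hV : ∀ x, Measurable (V x)) (hH : HolderWith μ V C s)
    {τ : ℝ} (hτ0 : 0 < τ) (hτs : τ < s) :
    ∃ K : ℝ, 0 < K ∧ ∀ (g : ℝ), g ≠ 0 → ∀ (x : Fin d → ℤ) (Ψ : Ω → ℝ≥0∞) (b : Ω → ℂ),
      Measurable[sigmaAlg V {x}ᶜ] Ψ → Measurable[sigmaAlg V {x}ᶜ] b →
      ∫⁻ ω, Ψ ω * ‖(((g * V x ω : ℝ) : ℂ) - b ω)⁻¹‖ₑ ^ τ ∂μ ≤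
        ENNReal.ofReal (K * |g| ^ (-τ)) * ∫⁻ ω, Ψ ω ∂μ := by
  set A : ℕ → ℝ≥0∞ := fun n => ENNReal.ofReal (((2 : ℝ) ^ (n + 1)) ^ τ) with hA
  -- The summand `1` accounts for `t > 1`, the series for the dyadic shells of `t ≤ 1`.
  set K' : ℝ≥0∞ := 1 + ∑' n, A n * (4 * ENNReal.ofReal (C * ((1 / 2 : ℝ) ^ n) ^ s)) with hK'
  have hfin : K' ≠ ∞ := by
    have h1 : ∀ n, A n * (4 * ENNReal.ofReal (C * ((1 / 2 : ℝ) ^ n) ^ s)) ≤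
        (ENNReal.ofReal (2 ^ τ) * 4 * ENNReal.ofReal |C|) *
          ENNReal.ofReal ((2 : ℝ) ^ (τ - s)) ^ n := by
      intro n
      have e1 : ((2 : ℝ) ^ (n + 1)) ^ τ = 2 ^ τ * 2 ^ (τ * n) := by
        rw [← Real.rpow_natCast, ← Real.rpow_mul (by norm_num), ← Real.rpow_add (by norm_num)]
        congr 1; push_cast; ring
      have e2 : ((1 / 2 : ℝ) ^ n) ^ s = 2 ^ (-s * n) := by
        rw [one_div, ← Real.rpow_natCast, ← Real.rpow_neg_one, ← Real.rpow_mul (by norm_num),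
          ← Real.rpow_mul (by norm_num)]
        congr 1; ring
      have e3 : ((2 : ℝ) ^ (τ - s)) ^ n = 2 ^ (τ * n) * 2 ^ (-s * n) := by
        rw [← Real.rpow_natCast, ← Real.rpow_mul (by norm_num), ← Real.rpow_add (by norm_num)]
        congr 1; ring
      rw [← ENNReal.ofReal_pow (by positivity), e3, hA]
      simp only
      rw [e1, e2, ENNReal.ofReal_mul (p := 2 ^ τ) (by positivity),
        ENNReal.ofReal_mul (p := 2 ^ (τ * n)) (by positivity),
        ENNReal.ofReal_mul' (q := 2 ^ (-s * n)) (by positivity)]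
      calc _ ≤ ENNReal.ofReal (2 ^ τ) * ENNReal.ofReal (2 ^ (τ * n)) *
            (4 * (ENNReal.ofReal |C| * ENNReal.ofReal (2 ^ (-s * n)))) := by
            gcongr
            exact le_abs_self C
        _ = _ := by ring
    have h2 : ∑' n, A n * (4 * ENNReal.ofReal (C * ((1 / 2 : ℝ) ^ n) ^ s)) ≠ ∞ := by
      refine ne_top_of_le_ne_top ?_ (ENNReal.tsum_le_tsum h1)
      rw [ENNReal.tsum_mul_left, ENNReal.tsum_geometric]
      refine ENNReal.mul_ne_top (by finiteness) (ENNReal.inv_ne_top.2 ?_)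
      have h3 : ENNReal.ofReal ((2 : ℝ) ^ (τ - s)) < 1 := by
        rw [ENNReal.ofReal_lt_one]
        exact Real.rpow_lt_one_of_one_lt_of_neg (by norm_num) (by linarith)
      exact (tsub_pos_of_lt h3).ne'
    exact ENNReal.add_ne_top.2 ⟨ENNReal.one_ne_top, h2⟩
  refine ⟨K'.toReal, ENNReal.toReal_pos ?_ hfin, fun g hg x Ψ b hΨ hb => ?_⟩
  · rw [hK']; exact (lt_of_lt_of_le zero_lt_one le_self_add).ne'
  have hm := sigmaAlg_le hV ({x}ᶜ : Set (Fin d → ℤ))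
  have hΨ' : Measurable Ψ := hΨ.mono hm le_rfl
  have hbr : Measurable[sigmaAlg V {x}ᶜ] fun ω => (b ω).re / g :=
    (Complex.measurable_re.comp hb).div_const g
  set D : ℕ → Set Ω := fun n => {ω | |V x ω - (b ω).re / g| ≤ (1 / 2 : ℝ) ^ n} with hD
  have hDm : ∀ n, MeasurableSet (D n) := fun n =>
    measurableSet_le ((hV x).sub (hbr.mono hm le_rfl)).abs measurable_const
  have hg' : 0 < |g| := abs_pos.2 hg
  have hpt : ∀ ω, Ψ ω * ‖(((g * V x ω : ℝ) : ℂ) - b ω)⁻¹‖ₑ ^ τ ≤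
      ENNReal.ofReal (|g| ^ (-τ)) * (Ψ ω + ∑' n, A n * (D n).indicator Ψ ω) := by
    intro ω
    set Q : ℂ := ((g * V x ω : ℝ) : ℂ) - b ω with hQ
    -- By the convention `0⁻¹ = 0` the integrand vanishes here.
    by_cases hQ0 : Q = 0
    · rw [hQ0, inv_zero, enorm_zero, ENNReal.zero_rpow_of_pos hτ0, mul_zero]; exact zero_le
    have hQpos : 0 < ‖Q‖ := norm_pos_iff.2 hQ0
    set t := ‖Q‖ / |g| with ht
    have htpos : 0 < t := div_pos hQpos hg'
    have hQt : ‖Q‖ = |g| * t := by rw [ht]; field_simp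
    have hle : |V x ω - (b ω).re / g| ≤ t := by
      rw [ht, le_div_iff₀ hg', ← abs_mul]
      have h1 : (V x ω - (b ω).re / g) * g = Q.re := by
        rw [hQ, Complex.sub_re, Complex.ofReal_re]; field_simp
      rw [h1]
      exact Complex.abs_re_le_norm Q
    have hconv : ‖Q⁻¹‖ₑ ^ τ = ENNReal.ofReal (|g| ^ (-τ)) * ENNReal.ofReal ((t⁻¹) ^ τ) := by
      rw [← ofReal_norm, ENNReal.ofReal_rpow_of_nonneg (norm_nonneg _) hτ0.le, norm_inv, hQt,
        mul_inv, Real.mul_rpow (by positivity) (by positivity),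
        ENNReal.ofReal_mul (by positivity), Real.inv_rpow hg'.le, Real.rpow_neg hg'.le]
    rw [hconv, mul_left_comm]
    refine mul_le_mul_right ?_ _
    by_cases ht1 : 1 < t
    · refine le_trans ?_ le_self_add
      refine mul_le_of_le_one_right' ?_
      rw [ENNReal.ofReal_le_one]
      exact Real.rpow_le_one (by positivity) (inv_le_one_of_one_le₀ ht1.le) hτ0.le
    · obtain ⟨n, hn1, hn2⟩ := exists_nat_pow_near_of_lt_one htpos (not_lt.1 ht1)
        (show (0 : ℝ) < 1 / 2 by norm_num) (by norm_num)
      refine le_trans ?_ le_add_self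
      refine le_trans ?_ (ENNReal.le_tsum n)
      rw [Set.indicator_of_mem (by exact hle.trans hn2), mul_comm]
      refine mul_le_mul_left (ENNReal.ofReal_le_ofReal ?_) _
      refine Real.rpow_le_rpow (by positivity) ?_ hτ0.le
      rw [inv_le_comm₀ htpos (by positivity)]
      refine le_trans (le_of_eq ?_) hn1.le
      rw [one_div, inv_pow]
  calc _ ≤ ∫⁻ ω, ENNReal.ofReal (|g| ^ (-τ)) * (Ψ ω + ∑' n, A n * (D n).indicator Ψ ω) ∂μ :=
        lintegral_mono hpt
    _ = ENNReal.ofReal (|g| ^ (-τ)) *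
        (∫⁻ ω, Ψ ω ∂μ + ∑' n, A n * ∫⁻ ω in D n, Ψ ω ∂μ) := by
        rw [lintegral_const_mul' _ _ ENNReal.ofReal_ne_top, lintegral_add_left hΨ',
          lintegral_tsum fun n => ((hΨ'.indicator (hDm n)).const_mul _).aemeasurable]
        congr 3
        funext n
        rw [lintegral_const_mul' _ _ ENNReal.ofReal_ne_top, lintegral_indicator (hDm n)]
    _ ≤ ENNReal.ofReal (|g| ^ (-τ)) * (∫⁻ ω, Ψ ω ∂μ + ∑' n, A n *
        (4 * ENNReal.ofReal (C * ((1 / 2 : ℝ) ^ n) ^ s) * ∫⁻ ω, Ψ ω ∂μ)) := by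
        gcongr with n
        exact setLIntegral_abs_sub_le hV hH x (by positivity)
          (pow_le_one₀ (by norm_num) (by norm_num)) hΨ hbr
    _ = ENNReal.ofReal (K'.toReal * |g| ^ (-τ)) * ∫⁻ ω, Ψ ω ∂μ := by
        rw [mul_comm K'.toReal, ENNReal.ofReal_mul (by positivity), ENNReal.ofReal_toReal hfin, hK',
          mul_assoc, add_mul, one_mul, ← ENNReal.tsum_mul_right]
        simp only [mul_assoc]

end Holder

end MixingAnderson

/-! ### Exponential decay of fractional moments of the Green function -/

namespace MixingAnderson

open MeasureTheory
open scoped ENNReal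

variable {d : ℕ} {Ω : Type*}

/-- A function of the potential that does not depend on its value at `x`. -/
def IgnoresSite {α : Type*} (F : ((Fin d → ℤ) → ℝ) → α) (x : Fin d → ℤ) : Prop :=
  ∀ w t, F (Function.update w x t) = F w

/-- Overwriting the value at `x` by `0` leaves `F` unchanged and makes the field measurable with
respect to the other sites. -/
theorem IgnoresSite.measurable_comp {α : Type*} [MeasurableSpace α] {V : (Fin d → ℤ) → Ω → ℝ}
    {F : ((Fin d → ℤ) → ℝ) → α} {x : Fin d → ℤ} (hF : IgnoresSite F x) (hm : Measurable F) :
    Measurable[sigmaAlg V {x}ᶜ] fun ω => F fun y => V y ω := by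
  have h1 : (fun ω => F fun y => V y ω) =
      F ∘ fun ω => Function.update (fun y => V y ω) x 0 := by
    funext ω
    exact (hF _ _).symm
  rw [h1]
  refine hm.comp ?_
  refine @measurable_pi_lambda _ _ _ (sigmaAlg V {x}ᶜ) _ _ fun y => ?_
  by_cases hy : y = x
  · subst hy
    simp only [Function.update_self]
    exact measurable_const
  · simp only [Function.update_of_ne hy]
    have h2 : MeasurableSpace.comap (V y) inferInstance ≤ sigmaAlg V {x}ᶜ :=
      le_iSup₂_of_le y hy le_rfl
    exact (comap_measurable (V y)).mono h2 le_rfl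

variable [MeasurableSpace Ω]

/-- The single-site fractional moment bound, conditionally on the other sites. -/
def FractionalBound (μ : Measure Ω) (V : (Fin d → ℤ) → Ω → ℝ) (τ g : ℝ) (c : ℝ≥0∞) : Prop :=
  ∀ (x : Fin d → ℤ) (Ψ : Ω → ℝ≥0∞) (b : Ω → ℂ),
    Measurable[sigmaAlg V {x}ᶜ] Ψ → Measurable[sigmaAlg V {x}ᶜ] b →
      ∫⁻ ω, Ψ ω * ‖(((g * V x ω : ℝ) : ℂ) - b ω)⁻¹‖ₑ ^ τ ∂μ ≤ c * ∫⁻ ω, Ψ ω ∂μ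

theorem measurable_field {V : (Fin d → ℤ) → Ω → ℝ} (hV : ∀ x, Measurable (V x)) :
    Measurable fun ω y => V y ω := measurable_pi_lambda _ hV

/-- Subadditivity of `t ↦ t ^ τ` for `τ ≤ 1`; the weights are `0` or `1`, so the power leaves them
unchanged. -/
theorem enorm_sum_adj_mul_rpow_le {τ : ℝ} (hτ0 : 0 < τ) (hτ1 : τ ≤ 1) (S : Finset (Fin d → ℤ))
    (x : Fin d → ℤ) (f : (Fin d → ℤ) → ℂ) :
    ‖∑ u ∈ S, (adj x u : ℂ) * f u‖ₑ ^ τ ≤ ∑ u ∈ S, ENNReal.ofReal (adj x u) * ‖f u‖ₑ ^ τ := by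
  refine (Finset.le_sum_of_subadditive (fun a : ℂ => ‖a‖ₑ ^ τ) ?_ ?_ S _).trans ?_
  · simp [hτ0]
  · intro a b
    exact (ENNReal.rpow_le_rpow (enorm_add_le a b) hτ0.le).trans
      (ENNReal.rpow_add_le_add_rpow _ _ hτ0.le hτ1)
  · refine Finset.sum_le_sum fun u _ => ?_
    rw [adj]
    split_ifs
    · simp
    · simp [hτ0]

theorem sum_ofReal_adj_le (S : Finset (Fin d → ℤ)) (x : Fin d → ℤ) :
    ∑ u ∈ S, ENNReal.ofReal (adj x u) ≤ 3 ^ d := by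
  rw [← ENNReal.ofReal_sum_of_nonneg fun u _ => adj_nonneg x u]
  refine (ENNReal.ofReal_le_ofReal (sum_adj_le S x)).trans (le_of_eq ?_)
  rw [ENNReal.ofReal_pow (by norm_num)]
  norm_num

/-- Induction on `S` by removal of `x`. The Schur formula separates a factor controlled by the
single-site bound from Green functions of `S.erase x`, which ignore `x` and so can enter the weight.
Each removal costs `3 ^ d * c` and shortens the distance to `y` by at most one. The weight `Φ`
serves to condition on events outside `S`. -/
theorem lintegral_greenExt_rpow_le {μ : Measure Ω} {V : (Fin d → ℤ) → Ω → ℝ}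
    (hV : ∀ x, Measurable (V x)) {τ g : ℝ} {c : ℝ≥0∞} (hτ0 : 0 < τ) (hτ1 : τ ≤ 1)
    (hF : FractionalBound μ V τ g c) (hc : 3 ^ d * c ≤ 1) {z : ℂ} (hz : z.im ≠ 0)
    (S : Finset (Fin d → ℤ)) {x y : Fin d → ℤ} (hx : x ∈ S) (hy : y ∈ S)
    {Φ : ((Fin d → ℤ) → ℝ) → ℝ≥0∞} (hΦ : Measurable Φ) (hΦS : ∀ a ∈ S, IgnoresSite Φ a)
    {n : ℕ} (hn : n ≤ natDist x y) :
    ∫⁻ ω, Φ (fun u => V u ω) * ‖greenExt g z S (fun u => V u ω) x y‖ₑ ^ τ ∂μ ≤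
      c * (3 ^ d * c) ^ n * ∫⁻ ω, Φ (fun u => V u ω) ∂μ := by
  induction S using Finset.strongInduction generalizing x n with
  | H S ih =>
  have hVm := measurable_field hV
  set Q : Ω → ℂ := fun ω =>
    ((g * V x ω : ℝ) : ℂ) - selfEnergy g z S (fun u => V u ω) x with hQ
  set X : ((Fin d → ℤ) → ℝ) → ℂ := fun w =>
    if x = y then 1 else ∑ u ∈ S.erase x, (adj x u : ℂ) * greenExt g z (S.erase x) w u y with hX
  have hQ0 : ∀ ω, Q ω ≠ 0 := fun ω h => by
    have h1 := schur_greenExt (g := g) hz (fun u => V u ω) hx hx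
    rw [if_pos rfl] at h1
    change Q ω * _ = 1 at h1
    rw [h, zero_mul] at h1
    exact zero_ne_one h1
  have hG : ∀ ω, ‖greenExt g z S (fun u => V u ω) x y‖ₑ ^ τ =
      ‖X fun u => V u ω‖ₑ ^ τ * ‖(Q ω)⁻¹‖ₑ ^ τ := fun ω => by
    have h1 := schur_greenExt (g := g) hz (fun u => V u ω) hx hy
    change Q ω * _ = X (fun u => V u ω) at h1
    rw [← h1, ← ENNReal.mul_rpow_of_nonneg _ _ hτ0.le, ← enorm_mul]
    congr 2
    field_simp [hQ0 ω]
  have hXc : Continuous X := by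
    rw [hX]
    by_cases hxy : x = y
    · simp only [hxy, if_true]; exact continuous_const
    · simp only [hxy, if_false]
      exact continuous_finsetSum _ fun u _ => continuous_const.mul (continuous_greenExt g hz _ u y)
  have hXi : IgnoresSite X x := fun w t => by
    simp only [hX, greenExt_update (Finset.notMem_erase x S)]
  have hXm : Measurable fun w => ‖X w‖ₑ ^ τ := hXc.measurable.enorm.pow_const τ
  have hΨi : IgnoresSite (fun w => Φ w * ‖X w‖ₑ ^ τ) x := fun w t => by
    simp only [hXi w t, hΦS x hx w t]
  have hstep : ∫⁻ ω, Φ (fun u => V u ω) * ‖greenExt g z S (fun u => V u ω) x y‖ₑ ^ τ ∂μ ≤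
      c * ∫⁻ ω, Φ (fun u => V u ω) * ‖X fun u => V u ω‖ₑ ^ τ ∂μ := by
    refine le_trans (le_of_eq ?_) (hF x _ (fun ω => selfEnergy g z S (fun u => V u ω) x)
      (hΨi.measurable_comp (hΦ.mul hXm))
      (IgnoresSite.measurable_comp (F := fun w => selfEnergy g z S w x)
        (fun w t => selfEnergy_update g z S w x t) (continuous_selfEnergy g hz S x).measurable))
    refine lintegral_congr fun ω => ?_
    rw [hG, mul_assoc]
  refine hstep.trans ?_
  rw [mul_assoc]
  refine mul_le_mul_right ?_ c
  by_cases hxy : x = y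
  · have hn0 : n = 0 := by
      rw [hxy, natDist_self] at hn
      omega
    simp [hX, hxy, hn0]
  · have hΦS' : ∀ a ∈ S.erase x, IgnoresSite Φ a := fun a ha => hΦS a (Finset.mem_of_mem_erase ha)
    have hterm : ∀ u ∈ S.erase x, ENNReal.ofReal (adj x u) *
        ∫⁻ ω, Φ (fun u => V u ω) * ‖greenExt g z (S.erase x) (fun u => V u ω) u y‖ₑ ^ τ ∂μ ≤
        ENNReal.ofReal (adj x u) * (c * (3 ^ d * c) ^ (n - 1) * ∫⁻ ω, Φ (fun u => V u ω) ∂μ) := by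
      intro u hu
      by_cases hadj : adj x u = 0
      · simp [hadj]
      · refine mul_le_mul_right ?_ _
        refine ih (S.erase x) (Finset.erase_ssubset hx) hu (Finset.mem_erase.2 ⟨Ne.symm hxy, hy⟩)
          hΦS' ?_
        have h1 := natDist_le_one_of_adj hadj
        have h2 := natDist_triangle x u y
        omega
    calc ∫⁻ ω, Φ (fun u => V u ω) * ‖X fun u => V u ω‖ₑ ^ τ ∂μ
        ≤ ∫⁻ ω, ∑ u ∈ S.erase x, ENNReal.ofReal (adj x u) * (Φ (fun u => V u ω) *
            ‖greenExt g z (S.erase x) (fun u => V u ω) u y‖ₑ ^ τ) ∂μ := by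
          refine lintegral_mono fun ω => ?_
          simp only [hX, hxy, if_false]
          refine (mul_le_mul_right (enorm_sum_adj_mul_rpow_le hτ0 hτ1 _ _ _) _).trans
            (le_of_eq ?_)
          rw [Finset.mul_sum]
          exact Finset.sum_congr rfl fun u _ => mul_left_comm _ _ _
      _ = ∑ u ∈ S.erase x, ENNReal.ofReal (adj x u) * ∫⁻ ω, Φ (fun u => V u ω) *
            ‖greenExt g z (S.erase x) (fun u => V u ω) u y‖ₑ ^ τ ∂μ := by
          have hm : ∀ u, Measurable fun ω => Φ (fun u => V u ω) *
              ‖greenExt g z (S.erase x) (fun u => V u ω) u y‖ₑ ^ τ := fun u =>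
            (hΦ.comp hVm).mul
              (((continuous_greenExt g hz _ u y).measurable.comp hVm).enorm.pow_const τ)
          rw [lintegral_finsetSum _ fun u _ => (hm u).const_mul _]
          exact Finset.sum_congr rfl fun u _ => lintegral_const_mul _ (hm u)
      _ ≤ ∑ u ∈ S.erase x, ENNReal.ofReal (adj x u) *
            (c * (3 ^ d * c) ^ (n - 1) * ∫⁻ ω, Φ (fun u => V u ω) ∂μ) := Finset.sum_le_sum hterm
      _ ≤ 3 ^ d * (c * (3 ^ d * c) ^ (n - 1) * ∫⁻ ω, Φ (fun u => V u ω) ∂μ) := by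
          rw [← Finset.sum_mul]
          exact mul_le_mul_left (sum_ofReal_adj_le _ _) _
      _ = (3 ^ d * c) ^ (n - 1 + 1) * ∫⁻ ω, Φ (fun u => V u ω) ∂μ := by
          rw [pow_succ]; ring
      -- With truncated subtraction `n - 1 + 1` may exceed `n`, namely for `n = 0`; the factor is at
      -- most one, so this is harmless.
      _ ≤ (3 ^ d * c) ^ n * ∫⁻ ω, Φ (fun u => V u ω) ∂μ :=
          mul_le_mul_left (pow_le_pow_right_of_le_one' hc (by omega)) _

/-- A measurable event of the potential that does not depend on the sites of `S`. -/
structure OutsideEvent (S : Finset (Fin d → ℤ)) (A : Set ((Fin d → ℤ) → ℝ)) : Prop where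
  measurableSet : MeasurableSet A
  update_mem_iff : ∀ a ∈ S, ∀ w t, Function.update w a t ∈ A ↔ w ∈ A

theorem OutsideEvent.univ (S : Finset (Fin d → ℤ)) :
    OutsideEvent S (Set.univ : Set ((Fin d → ℤ) → ℝ)) :=
  ⟨MeasurableSet.univ, fun _ _ _ _ => by simp⟩

/-- The data of the fractional moment method: exponent `τ`, coupling `g`, decay factor `q`. -/
structure FractionalDecay (μ : Measure Ω) (V : (Fin d → ℤ) → Ω → ℝ) (τ g q : ℝ) : Prop where
  τ_pos : 0 < τ
  τ_le_one : τ ≤ 1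
  q_pos : 0 < q
  q_le_one : q ≤ 1
  bound : ∃ c : ℝ≥0∞, FractionalBound μ V τ g c ∧ 3 ^ d * c ≤ ENNReal.ofReal q

/-- Markov's inequality for the `τ`-th moment, weighted by the indicator of `A`. The prefactor `c ≤
1` is dropped. -/
theorem FractionalDecay.measure_le_norm_greenExt {μ : Measure Ω} {V : (Fin d → ℤ) → Ω → ℝ}
    (hV : ∀ x, Measurable (V x)) {τ g q : ℝ} (hD : FractionalDecay μ V τ g q) {z : ℂ}
    (hz : z.im ≠ 0) {S : Finset (Fin d → ℤ)} {x y : Fin d → ℤ} (hx : x ∈ S) (hy : y ∈ S)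
    {A : Set ((Fin d → ℤ) → ℝ)} (hA : OutsideEvent S A) {n : ℕ} (hn : n ≤ natDist x y)
    {a : ℝ} (ha : 0 < a) :
    μ {ω | (fun u => V u ω) ∈ A ∧ a ≤ ‖greenExt g z S (fun u => V u ω) x y‖} ≤
      ENNReal.ofReal (a ^ (-τ) * q ^ n) * μ {ω | (fun u => V u ω) ∈ A} := by
  obtain ⟨c, hF, hcq⟩ := hD.bound
  have hτ0 := hD.τ_pos
  have hVm := measurable_field hV
  have hq1 : ENNReal.ofReal q ≤ 1 := ENNReal.ofReal_le_one.2 hD.q_le_one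
  have hc1 : c ≤ 1 := le_trans (le_mul_of_one_le_left' (one_le_pow₀ (by norm_num)))
    (hcq.trans hq1)
  set Φ : ((Fin d → ℤ) → ℝ) → ℝ≥0∞ := A.indicator fun _ => 1 with hΦ
  have hΦi : ∀ b ∈ S, IgnoresSite Φ b := fun b hb w t => by
    by_cases hw : w ∈ A
    · rw [hΦ, Set.indicator_of_mem hw, Set.indicator_of_mem ((hA.update_mem_iff b hb w t).2 hw)]
    · rw [hΦ, Set.indicator_of_notMem hw,
        Set.indicator_of_notMem fun h => hw ((hA.update_mem_iff b hb w t).1 h)]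
  have h1 := lintegral_greenExt_rpow_le (Φ := Φ) hV hτ0 hD.τ_le_one hF (hcq.trans hq1) hz S hx hy
    (measurable_const.indicator hA.measurableSet : Measurable Φ) hΦi hn
  have hint : ∫⁻ ω, Φ (fun u => V u ω) ∂μ = μ {ω | (fun u => V u ω) ∈ A} := by
    exact lintegral_indicator_one (hVm hA.measurableSet)
  rw [hint] at h1
  have h2 := mul_meas_ge_le_lintegral₀ (μ := μ)
    (f := fun ω => Φ (fun u => V u ω) * ‖greenExt g z S (fun u => V u ω) x y‖ₑ ^ τ)
    (((measurable_const.indicator hA.measurableSet : Measurable Φ).comp hVm).mul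
      (((continuous_greenExt g hz S x y).measurable.comp hVm).enorm.pow_const τ)).aemeasurable
    (ENNReal.ofReal (a ^ τ))
  have h3 : μ {ω | (fun u => V u ω) ∈ A ∧ a ≤ ‖greenExt g z S (fun u => V u ω) x y‖} ≤
      μ {ω | ENNReal.ofReal (a ^ τ) ≤
        Φ (fun u => V u ω) * ‖greenExt g z S (fun u => V u ω) x y‖ₑ ^ τ} := by
    refine measure_mono fun ω hω => ?_
    simp only [Set.mem_ofPred_eq] at hω ⊢
    rw [hΦ, Set.indicator_of_mem hω.1, one_mul, ← ofReal_norm,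
      ENNReal.ofReal_rpow_of_nonneg (norm_nonneg _) hτ0.le]
    exact ENNReal.ofReal_le_ofReal (Real.rpow_le_rpow ha.le hω.2 hτ0.le)
  have h4 : ENNReal.ofReal (a ^ τ) * μ {ω | (fun u => V u ω) ∈ A ∧
      a ≤ ‖greenExt g z S (fun u => V u ω) x y‖} ≤
      ENNReal.ofReal q ^ n * μ {ω | (fun u => V u ω) ∈ A} := by
    refine (mul_le_mul_right h3 _).trans (h2.trans (h1.trans ?_))
    refine mul_le_mul_left ?_ _
    calc c * (3 ^ d * c) ^ n ≤ 1 * ENNReal.ofReal q ^ n := by gcongr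
      _ = _ := one_mul _
  have hinv : ENNReal.ofReal (a ^ (-τ)) * ENNReal.ofReal (a ^ τ) = 1 := by
    rw [← ENNReal.ofReal_mul (by positivity), ← Real.rpow_add ha, neg_add_cancel, Real.rpow_zero,
      ENNReal.ofReal_one]
  calc _ = ENNReal.ofReal (a ^ (-τ)) * (ENNReal.ofReal (a ^ τ) * μ {ω | (fun u => V u ω) ∈ A ∧
      a ≤ ‖greenExt g z S (fun u => V u ω) x y‖}) := by rw [← mul_assoc, hinv, one_mul]
    _ ≤ ENNReal.ofReal (a ^ (-τ)) *
        (ENNReal.ofReal q ^ n * μ {ω | (fun u => V u ω) ∈ A}) := mul_le_mul_right h4 _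
    _ = _ := by
        rw [ENNReal.ofReal_mul (by positivity), ENNReal.ofReal_pow hD.q_pos.le, mul_assoc]

end MixingAnderson

/-! ### Approximate eigenvalues -/

namespace MixingAnderson

open MeasureTheory
open scoped ENNReal

variable {d : ℕ}

/-- The energy `E` is within about `ε` of the spectrum: there is an approximate eigenfunction,
with respect to the supremum norm. -/
def Near (g : ℝ) (S : Finset (Fin d → ℤ)) (E ε : ℝ) (w : (Fin d → ℤ) → ℝ) : Prop :=
  ∃ (φ : (Fin d → ℤ) → ℂ) (x₀ : Fin d → ℤ), x₀ ∈ S ∧ (∀ x ∈ S, ‖φ x‖ ≤ ‖φ x₀‖) ∧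
    ∀ x ∈ S, ‖hamApply g w S φ x - E * φ x‖ < ε * ‖φ x₀‖

theorem continuous_hamApply (g : ℝ) (S : Finset (Fin d → ℤ)) (φ : (Fin d → ℤ) → ℂ)
    (x : Fin d → ℤ) : Continuous fun w => hamApply g w S φ x := by
  unfold hamApply
  refine continuous_finsetSum _ fun u _ => Continuous.mul ?_ continuous_const
  refine Complex.continuous_ofReal.comp ?_
  unfold ham
  by_cases h : x = u
  · simp only [h, if_true]; fun_prop
  · simp only [h, if_false]; fun_prop

/-- For fixed `φ` and `x₀` there are finitely many strict inequalities, continuous in `w`. Openness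
survives the uncountable union over `φ`, and so provides measurability. -/
theorem isOpen_near (g : ℝ) (S : Finset (Fin d → ℤ)) (E ε : ℝ) : IsOpen {w | Near g S E ε w} := by
  have h : {w | Near g S E ε w} = ⋃ (φ : (Fin d → ℤ) → ℂ) (x₀ : Fin d → ℤ)
      (_ : x₀ ∈ S ∧ ∀ x ∈ S, ‖φ x‖ ≤ ‖φ x₀‖),
      ⋂ x ∈ S, {w | ‖hamApply g w S φ x - E * φ x‖ < ε * ‖φ x₀‖} := by
    ext w
    simp only [Near, Set.mem_ofPred_eq, Set.mem_iUnion, Set.mem_iInter, exists_prop, and_assoc]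
  rw [h]
  refine isOpen_iUnion fun φ => isOpen_iUnion fun x₀ => isOpen_iUnion fun _ =>
    isOpen_biInter_finset fun x _ => ?_
  exact isOpen_lt ((continuous_hamApply g S φ x).sub continuous_const).norm continuous_const

theorem Near.outsideEvent (g : ℝ) {S S' : Finset (Fin d → ℤ)} (h : Disjoint S S') (E ε : ℝ) :
    OutsideEvent S' {w | Near g S E ε w} := by
  refine ⟨(isOpen_near g S E ε).measurableSet, fun a ha w t => ?_⟩
  have h1 : ∀ x ∈ S, ∀ φ, hamApply g (Function.update w a t) S φ x = hamApply g w S φ x := by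
    intro x hx φ
    refine hamApply_update ?_ t S φ
    rintro rfl
    exact Finset.disjoint_left.1 h hx ha
  simp only [Set.mem_ofPred_eq, Near]
  constructor
  · rintro ⟨φ, x₀, hx₀, h2, h3⟩
    exact ⟨φ, x₀, hx₀, h2, fun x hx => by rw [← h1 x hx]; exact h3 x hx⟩
  · rintro ⟨φ, x₀, hx₀, h2, h3⟩
    exact ⟨φ, x₀, hx₀, h2, fun x hx => by rw [h1 x hx]; exact h3 x hx⟩

theorem Near.shift {g : ℝ} {S : Finset (Fin d → ℤ)} {E ε : ℝ} {w : (Fin d → ℤ) → ℝ}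
    (h : Near g S E ε w) {E' δ : ℝ} (hE : |E - E'| ≤ δ) : Near g S E' (ε + δ) w := by
  obtain ⟨φ, x₀, hx₀, h2, h3⟩ := h
  refine ⟨φ, x₀, hx₀, h2, fun x hx => ?_⟩
  have h4 : hamApply g w S φ x - E' * φ x =
      (hamApply g w S φ x - E * φ x) + ((E - E' : ℝ) : ℂ) * φ x := by push_cast; ring
  rw [h4, add_mul]
  refine (norm_add_le _ _).trans_lt (add_lt_add_of_lt_of_le (h3 x hx) ?_)
  rw [norm_mul, Complex.norm_real, Real.norm_eq_abs]
  exact mul_le_mul hE (h2 x hx) (norm_nonneg _) ((abs_nonneg _).trans hE)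

theorem norm_sub_mul_lt {g : ℝ} {S : Finset (Fin d → ℤ)} {E ε : ℝ} {w : (Fin d → ℤ) → ℝ}
    {φ : (Fin d → ℤ) → ℂ} {x : Fin d → ℤ} {M : ℝ}
    (h : ‖hamApply g w S φ x - E * φ x‖ < ε * M) (hM : ‖φ x‖ ≤ M) (η : ℝ) :
    ‖hamApply g w S φ x - (E + η * Complex.I) * φ x‖ < (ε + |η|) * M := by
  have h4 : hamApply g w S φ x - (E + η * Complex.I) * φ x =
      (hamApply g w S φ x - E * φ x) - (η * Complex.I) * φ x := by ring
  rw [h4, add_mul]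
  refine (norm_sub_le _ _).trans_lt (add_lt_add_of_lt_of_le h ?_)
  rw [norm_mul, norm_mul, Complex.norm_I, mul_one, Complex.norm_real, Real.norm_eq_abs]
  exact mul_le_mul_of_nonneg_left hM (abs_nonneg _)

theorem im_add_mul_I (E η : ℝ) : ((E : ℂ) + η * Complex.I).im = η := by simp

/-- At energy `E + iε` the approximate eigenfunction has a source smaller than `2 ε ‖φ x₀‖`. If all
entries of the Green function were below the bound, the representation of `φ x₀` would give `‖φ x₀‖
< ‖φ x₀‖`. -/
theorem Near.exists_greenExt {g : ℝ} {S : Finset (Fin d → ℤ)} {E ε : ℝ} {w : (Fin d → ℤ) → ℝ}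
    (h : Near g S E ε w) (hε : 0 < ε) :
    ∃ x ∈ S, ∃ y ∈ S, (2 * ε * S.card)⁻¹ ≤ ‖greenExt g (E + ε * Complex.I) S w x y‖ := by
  obtain ⟨φ, x₀, hx₀, h2, h3⟩ := h
  set z : ℂ := E + ε * Complex.I with hz
  have hzim : z.im ≠ 0 := by rw [hz, im_add_mul_I]; exact hε.ne'
  by_contra hcon
  push Not at hcon
  have hpos : 0 < ‖φ x₀‖ := by
    have h4 := (norm_nonneg _).trans_lt (h3 x₀ hx₀)
    exact (mul_pos_iff_of_pos_left hε).1 h4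
  have hcard : 0 < (S.card : ℝ) := by exact_mod_cast Finset.card_pos.2 ⟨x₀, hx₀⟩
  have h5 : ∀ x ∈ S, ‖hamApply g w S φ x - z * φ x‖ < 2 * ε * ‖φ x₀‖ := fun x hx => by
    have h6 := norm_sub_mul_lt (h3 x hx) (h2 x hx) ε
    rwa [abs_of_pos hε, ← two_mul] at h6
  have h7 := eq_sum_greenExt (g := g) (w := w) (S := S) hzim (f := φ)
    (ρ := fun x => hamApply g w S φ x - z * φ x) (fun _ _ => rfl) hx₀
  have h8 : ‖φ x₀‖ < ∑ _y ∈ S, (2 * ε * S.card)⁻¹ * (2 * ε * ‖φ x₀‖) := by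
    conv_lhs => rw [h7]
    refine (norm_sum_le _ _).trans_lt (Finset.sum_lt_sum_of_nonempty ⟨x₀, hx₀⟩ fun y hy => ?_)
    rw [norm_mul]
    exact mul_lt_mul'' (hcon x₀ hx₀ y hy) (h5 y hy) (norm_nonneg _) (norm_nonneg _)
  rw [Finset.sum_const, nsmul_eq_mul] at h8
  have h9 : (S.card : ℝ) * ((2 * ε * S.card)⁻¹ * (2 * ε * ‖φ x₀‖)) = ‖φ x₀‖ := by
    field_simp
  rw [h9] at h8
  exact lt_irrefl _ h8

theorem norm_greenExt_le_sum (g : ℝ) (S : Finset (Fin d → ℤ)) (w : (Fin d → ℤ) → ℝ) {z : ℂ}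
    (hz : z.im ≠ 0) (x y : Fin d → ℤ) :
    ‖greenExt g z S w x y‖ ≤
      ∑ i, ‖((hamMatrix_isHermitian g w S).eigenvalues i : ℂ) - z‖⁻¹ := by
  by_cases h : x ∈ S ∧ y ∈ S
  swap
  · rw [greenExt, dif_neg h, norm_zero]
    exact Finset.sum_nonneg fun i _ => inv_nonneg.2 (norm_nonneg _)
  rw [greenExt, dif_pos h]
  set hA := hamMatrix_isHermitian g w S with hAdef
  set U : Matrix S S ℂ := (hA.eigenvectorUnitary : Matrix S S ℂ) with hU
  have hUU : U * star U = 1 := Unitary.mul_star_self_of_mem hA.eigenvectorUnitary.2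
  have hUU' : star U * U = 1 := Unitary.star_mul_self_of_mem hA.eigenvectorUnitary.2
  set Λ : S → ℂ := fun i => (hA.eigenvalues i : ℂ) with hΛ
  have hne : ∀ i, Λ i - z ≠ 0 := fun i h0 => hz (by
    rw [← sub_eq_zero.1 h0]; exact Complex.ofReal_im _)
  have hspec : hamMatrix g w S = U * Matrix.diagonal Λ * star U := by
    have h1 := hA.spectral_theorem
    rw [Unitary.conjStarAlgAut_apply] at h1
    exact h1
  have hinv : (hamMatrix g w S - z • (1 : Matrix S S ℂ))⁻¹ =
      U * Matrix.diagonal (fun i => (Λ i - z)⁻¹) * star U := by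
    refine Matrix.inv_eq_right_inv ?_
    have h2 : hamMatrix g w S - z • (1 : Matrix S S ℂ) =
        U * Matrix.diagonal (fun i => Λ i - z) * star U := by
      have h3 : Matrix.diagonal (fun i => Λ i - z) =
          Matrix.diagonal Λ - z • (1 : Matrix S S ℂ) := by
        rw [Matrix.smul_one_eq_diagonal, Matrix.diagonal_sub]
      rw [h3, Matrix.mul_sub, Matrix.sub_mul, ← hspec, Matrix.mul_smul, Matrix.mul_one,
        Matrix.smul_mul, hUU]
    rw [h2]
    calc U * Matrix.diagonal (fun i => Λ i - z) * star U *
          (U * Matrix.diagonal (fun i => (Λ i - z)⁻¹) * star U)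
        = U * (Matrix.diagonal (fun i => Λ i - z) * (star U * U) *
          Matrix.diagonal (fun i => (Λ i - z)⁻¹)) * star U := by
          simp only [Matrix.mul_assoc]
      _ = 1 := by
          rw [hUU', Matrix.mul_one, Matrix.diagonal_mul_diagonal]
          simp only [mul_inv_cancel₀ (hne _), Matrix.diagonal_one, Matrix.mul_one, hUU]
  rw [hinv, Matrix.mul_apply]
  refine (norm_sum_le _ _).trans (Finset.sum_le_sum fun i _ => ?_)
  rw [Matrix.mul_diagonal, norm_mul, norm_mul, norm_inv, Matrix.star_apply, norm_star]
  have hb : ∀ a b, ‖U a b‖ ≤ 1 := fun a b => entry_norm_bound_of_unitary hA.eigenvectorUnitary.2 a b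
  calc ‖U ⟨x, h.1⟩ i‖ * ‖Λ i - z‖⁻¹ * ‖U ⟨y, h.2⟩ i‖ ≤ 1 * ‖Λ i - z‖⁻¹ * 1 := by
        gcongr
        · exact hb _ _
        · exact hb _ _
    _ = ‖Λ i - z‖⁻¹ := by ring

/-- A large entry of the Green function forces a small denominator in its spectral representation.
This is used to count the grid energies close to the spectrum. -/
theorem Near.exists_eigenvalue {g : ℝ} {S : Finset (Fin d → ℤ)} {E ε : ℝ}
    {w : (Fin d → ℤ) → ℝ} (h : Near g S E ε w) (hε : 0 < ε) :
    ∃ i, |(hamMatrix_isHermitian g w S).eigenvalues i - E| ≤ 2 * ε * S.card ^ 2 := by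
  obtain ⟨x, hx, y, hy, hxy⟩ := h.exists_greenExt hε
  have hcard : 0 < (S.card : ℝ) := by exact_mod_cast Finset.card_pos.2 ⟨x, hx⟩
  set z : ℂ := E + ε * Complex.I with hz
  have hzim : z.im ≠ 0 := by rw [hz, im_add_mul_I]; exact hε.ne'
  by_contra hcon
  push Not at hcon
  have h1 := hxy.trans (norm_greenExt_le_sum g S w hzim x y)
  have h2 : ∑ i, ‖((hamMatrix_isHermitian g w S).eigenvalues i : ℂ) - z‖⁻¹ <
      ∑ _i : S, (2 * ε * (S.card : ℝ) ^ 2)⁻¹ := by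
    refine Finset.sum_lt_sum_of_nonempty ⟨⟨x, hx⟩, Finset.mem_univ _⟩ fun i _ => ?_
    refine inv_strictAnti₀ (by positivity) ((hcon i).trans_le ?_)
    have h3 := Complex.abs_re_le_norm (((hamMatrix_isHermitian g w S).eigenvalues i : ℂ) - z)
    simpa [hz] using h3
  rw [Finset.sum_const, Finset.card_univ, Fintype.card_coe, nsmul_eq_mul] at h2
  have h3 : (S.card : ℝ) * (2 * ε * (S.card : ℝ) ^ 2)⁻¹ = (2 * ε * S.card)⁻¹ := by
    field_simp
  rw [h3] at h2
  exact absurd h1 (not_le.2 h2)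

/-- Gershgorin's argument at the maximum of `‖φ‖`: the hopping terms contribute at most `3 ^ d` and
the defect at most `1`. An almost-eigenvalue is thereby located from the potential at one site. -/
theorem Near.exists_site {g : ℝ} {S : Finset (Fin d → ℤ)} {E ε : ℝ}
    {w : (Fin d → ℤ) → ℝ} (h : Near g S E ε w) (hε1 : ε ≤ 1) :
    ∃ x ∈ S, |g * w x + 2 * d - E| ≤ 3 ^ d + 1 := by
  obtain ⟨φ, x₀, hx₀, h2, h3⟩ := h
  refine ⟨x₀, hx₀, ?_⟩
  have h4 := h3 x₀ hx₀
  have hpos : 0 < ‖φ x₀‖ := by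
    by_contra h0
    have h00 : ‖φ x₀‖ = 0 := le_antisymm (not_lt.1 h0) (norm_nonneg _)
    rw [h00, mul_zero] at h4
    exact absurd h4 (not_lt.2 (norm_nonneg _))
  rw [hamApply_eq _ _ _ hx₀] at h4
  have h5 : ‖∑ u ∈ S, (adj x₀ u : ℂ) * φ u‖ ≤ 3 ^ d * ‖φ x₀‖ := by
    refine (norm_sum_le _ _).trans ?_
    refine le_trans (Finset.sum_le_sum (g := fun u => adj x₀ u * ‖φ x₀‖) fun u hu => ?_) ?_
    · rw [norm_mul, Complex.norm_real, Real.norm_eq_abs, abs_of_nonneg (adj_nonneg _ _)]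
      exact mul_le_mul_of_nonneg_left (h2 u hu) (adj_nonneg _ _)
    · rw [← Finset.sum_mul]
      exact mul_le_mul_of_nonneg_right (sum_adj_le S x₀) (norm_nonneg _)
  set s := ∑ u ∈ S, (adj x₀ u : ℂ) * φ u
  have h6 : ((g * w x₀ + 2 * d - E : ℝ) : ℂ) * φ x₀ =
      (((g * w x₀ + 2 * d : ℝ) : ℂ) * φ x₀ - s - E * φ x₀) + s := by push_cast; ring
  have h7 : |g * w x₀ + 2 * d - E| * ‖φ x₀‖ ≤ (3 ^ d + 1) * ‖φ x₀‖ := by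
    rw [← Real.norm_eq_abs, ← Complex.norm_real, ← norm_mul, h6]
    refine (norm_add_le _ _).trans ?_
    nlinarith [norm_nonneg (φ x₀)]
  exact le_of_mul_le_mul_right h7 hpos

theorem near_of_hamApply_eq {g : ℝ} {S : Finset (Fin d → ℤ)} {E ε : ℝ} {w : (Fin d → ℤ) → ℝ}
    (hε : 0 < ε) {φ : (Fin d → ℤ) → ℂ} (h : ∀ x ∈ S, hamApply g w S φ x = E * φ x)
    {x : Fin d → ℤ} (hx : x ∈ S) (hφ : φ x ≠ 0) : Near g S E ε w := by
  obtain ⟨x₀, hx₀, h1⟩ := Finset.exists_max_image S (fun u => ‖φ u‖) ⟨x, hx⟩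
  refine ⟨φ, x₀, hx₀, h1, fun u hu => ?_⟩
  rw [h u hu, sub_self, norm_zero]
  exact mul_pos hε ((norm_pos_iff.2 hφ).trans_le (h1 x hx))

/-- Away from the spectrum, solutions of `(H - E) f = ρ` are bounded. -/
theorem norm_le_of_not_near {g : ℝ} {S : Finset (Fin d → ℤ)} {E ε : ℝ} {w : (Fin d → ℤ) → ℝ}
    (hε : 0 < ε) (hN : ¬ Near g S E ε w) {f : (Fin d → ℤ) → ℂ} {r : ℝ}
    (h : ∀ x ∈ S, ‖hamApply g w S f x - E * f x‖ ≤ r) {x : Fin d → ℤ} (hx : x ∈ S) :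
    ‖f x‖ ≤ r / ε := by
  obtain ⟨x₀, hx₀, h1⟩ := Finset.exists_max_image S (fun u => ‖f u‖) ⟨x, hx⟩
  refine (h1 x hx).trans ?_
  rw [le_div_iff₀ hε]
  by_contra hcon
  exact hN ⟨f, x₀, hx₀, h1, fun u hu => (h u hu).trans_lt (by linarith)⟩

/-- The Green function is bounded at complex energies close to `E`. -/
theorem norm_greenExt_le_of_not_near {g : ℝ} {S : Finset (Fin d → ℤ)} {E ε : ℝ}
    {w : (Fin d → ℤ) → ℝ} (hε : 0 < ε) (hN : ¬ Near g S E ε w) {z : ℂ} (hz : z.im ≠ 0)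
    (hzE : ‖z - E‖ ≤ ε / 2) {x y : Fin d → ℤ} (hx : x ∈ S) (hy : y ∈ S) :
    ‖greenExt g z S w x y‖ ≤ 2 / ε := by
  set f : (Fin d → ℤ) → ℂ := fun u => greenExt g z S w u y with hf
  obtain ⟨x₀, hx₀, h1⟩ := Finset.exists_max_image S (fun u => ‖f u‖) ⟨x, hx⟩
  have h2 : ∀ u ∈ S, ‖hamApply g w S f u - E * f u‖ ≤ 1 + ε / 2 * ‖f x₀‖ := by
    intro u hu
    have h3 := hamApply_greenExt (g := g) (w := w) hz hu hy
    change hamApply g w S f u - z * f u = _ at h3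
    have h4 : hamApply g w S f u - E * f u = (if u = y then 1 else 0) + (z - E) * f u := by
      rw [← h3]; ring
    rw [h4]
    refine (norm_add_le _ _).trans (add_le_add ?_ ?_)
    · split_ifs <;> simp
    · rw [norm_mul]
      exact mul_le_mul hzE (h1 u hu) (norm_nonneg _) (by positivity)
  have h5 := norm_le_of_not_near hε hN h2 hx₀
  refine (h1 x hx).trans ?_
  rw [le_div_iff₀ hε] at h5 ⊢
  linarith

end MixingAnderson

/-! ### Wegner estimate and union bounds over energies -/

namespace MixingAnderson

open MeasureTheory
open scoped ENNReal

variable {d : ℕ} {Ω : Type*} [MeasurableSpace Ω] {μ : Measure Ω} {V : (Fin d → ℤ) → Ω → ℝ}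

/-- Wegner estimate, conditionally on the potential outside `S`. -/
theorem FractionalDecay.measure_near_le (hV : ∀ x, Measurable (V x)) {τ g q : ℝ}
    (hD : FractionalDecay μ V τ g q) {S : Finset (Fin d → ℤ)} {A : Set ((Fin d → ℤ) → ℝ)}
    (hA : OutsideEvent S A) (E : ℝ) {ε : ℝ} (hε : 0 < ε) :
    μ {ω | (fun u => V u ω) ∈ A ∧ Near g S E ε fun u => V u ω} ≤
      ENNReal.ofReal ((S.card : ℝ) ^ 2 * (2 * ε * S.card) ^ τ) *
        μ {ω | (fun u => V u ω) ∈ A} := by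
  set z : ℂ := E + ε * Complex.I with hz
  have hzim : z.im ≠ 0 := by rw [hz, im_add_mul_I]; exact hε.ne'
  set a : ℝ := (2 * ε * S.card)⁻¹ with ha
  have hsub : {ω | (fun u => V u ω) ∈ A ∧ Near g S E ε fun u => V u ω} ⊆
      ⋃ p ∈ S ×ˢ S, {ω | (fun u => V u ω) ∈ A ∧
        a ≤ ‖greenExt g z S (fun u => V u ω) p.1 p.2‖} := by
    rintro ω ⟨h1, h2⟩
    obtain ⟨x, hx, y, hy, hxy⟩ := h2.exists_greenExt hε
    exact Set.mem_biUnion (Finset.mem_product.2 ⟨hx, hy⟩ : (x, y) ∈ S ×ˢ S) ⟨h1, hxy⟩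
  refine (measure_mono hsub).trans ((measure_biUnion_finset_le _ _).trans ?_)
  by_cases hS : S.card = 0
  · rw [Finset.card_eq_zero.1 hS]; simp
  have hcard : 0 < (S.card : ℝ) := by exact_mod_cast Nat.pos_of_ne_zero hS
  have hapos : 0 < a := by positivity
  refine (Finset.sum_le_sum fun p hp => hD.measure_le_norm_greenExt hV hzim
    (Finset.mem_product.1 hp).1 (Finset.mem_product.1 hp).2 hA (Nat.zero_le _) hapos).trans
    (le_of_eq ?_)
  rw [Finset.sum_const, Finset.card_product, nsmul_eq_mul, ← mul_assoc, pow_zero, mul_one]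
  congr 1
  rw [ENNReal.ofReal_mul (by positivity), ha, Real.inv_rpow (by positivity),
    Real.rpow_neg (by positivity), inv_inv, ← Nat.cast_pow, ENNReal.ofReal_natCast, sq]

/-- Union bound over a grid of energies. -/
theorem measure_exists_int_le [IsProbabilityMeasure μ] (hV : ∀ x, Measurable (V x))
    {A : ℤ → Set ((Fin d → ℤ) → ℝ)} (hA : ∀ j, MeasurableSet (A j)) (Z : ℤ → Ω → Prop)
    {p M : ℝ≥0∞}
    (hp : ∀ j, μ {ω | (fun u => V u ω) ∈ A j ∧ Z j ω} ≤ p * μ {ω | (fun u => V u ω) ∈ A j})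
    (hM : ∀ w, ∑' j, (A j).indicator 1 w ≤ M) :
    μ {ω | ∃ j, (fun u => V u ω) ∈ A j ∧ Z j ω} ≤ p * M := by
  have hVm := measurable_field hV
  have h1 : {ω | ∃ j, (fun u => V u ω) ∈ A j ∧ Z j ω} =
      ⋃ j, {ω | (fun u => V u ω) ∈ A j ∧ Z j ω} := by
    ext ω; simp
  rw [h1]
  calc μ (⋃ j, {ω | (fun u => V u ω) ∈ A j ∧ Z j ω})
      ≤ ∑' j, μ {ω | (fun u => V u ω) ∈ A j ∧ Z j ω} := measure_iUnion_le _
    _ ≤ ∑' j, p * μ {ω | (fun u => V u ω) ∈ A j} := ENNReal.tsum_le_tsum hp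
    _ = p * ∑' j, μ {ω | (fun u => V u ω) ∈ A j} := ENNReal.tsum_mul_left
    -- The sum of the probabilities is the expected number of indices `j` with `A j` satisfied, so a
    -- bound on this number controls an infinite union.
    _ = p * ∑' j, ∫⁻ ω, (A j).indicator 1 (fun u => V u ω) ∂μ := by
        congr 1
        exact tsum_congr fun j => (lintegral_indicator_one (hVm (hA j))).symm
    _ = p * ∫⁻ ω, ∑' j, (A j).indicator 1 (fun u => V u ω) ∂μ := by
        congr 1
        exact (lintegral_tsum fun j =>
          ((measurable_one.indicator (hA j)).comp hVm).aemeasurable).symm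
    _ ≤ p * ∫⁻ _, M ∂μ := by gcongr with ω; exact hM _
    _ = p * M := by simp

theorem tsum_int_near_le (t : ℝ) {η D : ℝ} (hη : 0 < η) (hD : 0 ≤ D) :
    ∑' j : ℤ, (if |t - j * η| ≤ D then (1 : ℝ≥0∞) else 0) ≤ ENNReal.ofReal (2 * D / η + 1) := by
  set F : Finset ℤ := Finset.Icc ⌈(t - D) / η⌉ ⌊(t + D) / η⌋ with hF
  rw [tsum_eq_sum (s := F)]
  · refine (Finset.sum_le_card_nsmul F _ 1 fun j _ => by split_ifs <;> simp).trans ?_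
    rw [nsmul_eq_mul, mul_one, ← ENNReal.ofReal_natCast]
    refine ENNReal.ofReal_le_ofReal ?_
    rw [hF, Int.card_Icc]
    have h1 := Int.floor_le ((t + D) / η)
    have h2 := Int.le_ceil ((t - D) / η)
    have h3 : (t + D) / η - (t - D) / η = 2 * D / η := by ring
    have h4 : (((⌊(t + D) / η⌋ + 1 - ⌈(t - D) / η⌉).toNat : ℤ) : ℝ) ≤ 2 * D / η + 1 := by
      rw [Int.toNat_eq_max]
      push_cast
      refine max_le (by linarith) (by positivity)
    exact_mod_cast h4
  · intro j hj
    rw [if_neg]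
    intro h
    rw [abs_le] at h
    refine hj (Finset.mem_Icc.2 ⟨Int.ceil_le.2 ?_, Int.le_floor.2 ?_⟩)
    · rw [div_le_iff₀ hη]; linarith
    · rw [le_div_iff₀ hη]; linarith

/-- Decay of the Green function for all energies of a grid close to the potential at a site
outside `S`. -/
theorem FractionalDecay.measure_exists_greenExt_le [IsProbabilityMeasure μ]
    (hV : ∀ x, Measurable (V x)) {τ g q : ℝ}
    (hD : FractionalDecay μ V τ g q) {S : Finset (Fin d → ℤ)} {x z₀ : Fin d → ℤ} (hx : x ∈ S)
    (hz₀ : z₀ ∉ S) (r : ℕ) {a η D : ℝ} (ha : 0 < a) (hη : 0 < η) (hD0 : 0 ≤ D) :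
    μ {ω | ∃ j : ℤ, |g * V z₀ ω + 2 * d - j * η| ≤ D ∧ ∃ u ∈ S, r ≤ natDist x u ∧
      a ≤ ‖greenExt g (((j * η : ℝ) : ℂ) + η * Complex.I) S (fun u => V u ω) x u‖} ≤
      ENNReal.ofReal (S.card * (a ^ (-τ) * q ^ r) * (2 * D / η + 1)) := by
  have hq := hD.q_pos
  -- Relevance of a grid energy depends only on the site `z₀` outside `S`, so the conditional decay
  -- estimate applies to each one.
  set A : ℤ → Set ((Fin d → ℤ) → ℝ) := fun j => {w | |g * w z₀ + 2 * d - j * η| ≤ D} with hA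
  have hAm : ∀ j, MeasurableSet (A j) := fun j =>
    (isClosed_le (by fun_prop) continuous_const).measurableSet
  have hAo : ∀ j, OutsideEvent S (A j) := fun j => ⟨hAm j, fun b hb w t => by
    have hne : z₀ ≠ b := by rintro rfl; exact hz₀ hb
    simp only [hA, Set.mem_ofPred_eq, Function.update_of_ne hne]⟩
  rw [ENNReal.ofReal_mul (by positivity)]
  refine measure_exists_int_le hV hAm (fun j ω => ∃ u ∈ S, r ≤ natDist x u ∧
      a ≤ ‖greenExt g (((j * η : ℝ) : ℂ) + η * Complex.I) S (fun u => V u ω) x u‖)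
      (fun j => ?_) (fun w => ?_)
  · have hsub : {ω | (fun u => V u ω) ∈ A j ∧ ∃ u ∈ S, r ≤ natDist x u ∧
        a ≤ ‖greenExt g (((j * η : ℝ) : ℂ) + η * Complex.I) S (fun u => V u ω) x u‖} ⊆
        ⋃ u ∈ S.filter fun u => r ≤ natDist x u, {ω | (fun u => V u ω) ∈ A j ∧
          a ≤ ‖greenExt g (((j * η : ℝ) : ℂ) + η * Complex.I) S (fun u => V u ω) x u‖} := by
      rintro ω ⟨h1, u, hu, hr, h2⟩
      exact Set.mem_biUnion (show u ∈ (S.filter fun u => r ≤ natDist x u : Finset _) from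
        Finset.mem_filter.2 ⟨hu, hr⟩) ⟨h1, h2⟩
    refine (measure_mono hsub).trans ((measure_biUnion_finset_le _ _).trans ?_)
    refine (Finset.sum_le_card_nsmul _ _ (ENNReal.ofReal (a ^ (-τ) * q ^ r) *
      μ {ω | (fun u => V u ω) ∈ A j}) fun u hu => ?_).trans ?_
    · exact hD.measure_le_norm_greenExt hV (by rw [im_add_mul_I]; exact hη.ne') hx
        (Finset.mem_filter.1 hu).1 (hAo j) (Finset.mem_filter.1 hu).2 ha
    · rw [nsmul_eq_mul, ENNReal.ofReal_mul (p := S.card) (by positivity), ENNReal.ofReal_natCast,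
        ← mul_assoc]
      gcongr
      exact Finset.filter_subset _ _
  · refine le_trans (le_of_eq (tsum_congr fun j => ?_))
      (tsum_int_near_le (g * w z₀ + 2 * d) hη hD0)
    simp only [Set.indicator_apply, hA, Set.mem_ofPred_eq, Pi.one_apply]

/-- Eigenvalue comparison for two disjoint sets. -/
theorem FractionalDecay.measure_exists_near_le [IsProbabilityMeasure μ]
    (hV : ∀ x, Measurable (V x)) {τ g q : ℝ} (hD : FractionalDecay μ V τ g q)
    {S S' : Finset (Fin d → ℤ)} (hS : Disjoint S' S) {ε : ℝ} (hε : 0 < ε) :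
    μ {ω | ∃ j : ℤ, Near g S' (j * ε) (2 * ε) (fun u => V u ω) ∧
        Near g S (j * ε) (2 * ε) fun u => V u ω} ≤
      ENNReal.ofReal ((S.card : ℝ) ^ 2 * (4 * ε * S.card) ^ τ *
        (S'.card * (8 * S'.card ^ 2 + 1))) := by
  rw [ENNReal.ofReal_mul (by positivity)]
  refine measure_exists_int_le hV (A := fun j => {w | Near g S' (j * ε) (2 * ε) w})
    (fun j => (isOpen_near _ _ _ _).measurableSet)
    (fun j ω => Near g S (j * ε) (2 * ε) fun u => V u ω) (fun j => ?_) (fun w => ?_)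
  · refine (hD.measure_near_le hV (Near.outsideEvent g hS (j * ε) (2 * ε)) _
      (by positivity)).trans (le_of_eq ?_)
    congr 4
    ring
  · set lam := (hamMatrix_isHermitian g w S').eigenvalues with hlam
    -- The distance to an eigenvalue in `Near.exists_eigenvalue`, taken at width `2 * ε`. Each
    -- eigenvalue of `S'` then accounts for at most `2 * D / ε + 1` grid points.
    set D : ℝ := 4 * ε * S'.card ^ 2 with hDdef
    calc ∑' j : ℤ, Set.indicator {w | Near g S' (j * ε) (2 * ε) w}
          (1 : ((Fin d → ℤ) → ℝ) → ℝ≥0∞) w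
        ≤ ∑' j : ℤ, ∑ i, (if |lam i - j * ε| ≤ D then (1 : ℝ≥0∞) else 0) := by
          refine ENNReal.tsum_le_tsum fun j => ?_
          by_cases h : Near g S' (j * ε) (2 * ε) w
          · rw [Set.indicator_of_mem (by exact h)]
            obtain ⟨i, hi⟩ := Near.exists_eigenvalue h (by positivity)
            refine le_trans (le_of_eq ?_) (Finset.single_le_sum (fun _ _ => zero_le)
              (Finset.mem_univ i))
            rw [if_pos]
            · rfl
            · refine hi.trans (le_of_eq ?_)
              rw [hDdef]; ring
          · rw [Set.indicator_of_notMem (by exact h)]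
            exact zero_le
      _ = ∑ i, ∑' j : ℤ, (if |lam i - j * ε| ≤ D then (1 : ℝ≥0∞) else 0) :=
          Summable.tsum_finsetSum fun i _ => ENNReal.summable
      _ ≤ ∑ _i : S', ENNReal.ofReal (2 * D / ε + 1) :=
          Finset.sum_le_sum fun i _ => tsum_int_near_le _ hε (by positivity)
      _ = ENNReal.ofReal (S'.card * (8 * S'.card ^ 2 + 1)) := by
          rw [Finset.sum_const, Finset.card_univ, Fintype.card_coe, nsmul_eq_mul,
            ENNReal.ofReal_mul (by positivity), ENNReal.ofReal_natCast]
          congr 2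
          rw [hDdef]
          field_simp
          ring

/-! ### Eigenfunctions in the absence of resonances -/

theorem norm_add_mul_I_sub_le {E e η : ℝ} (h : |E - e| ≤ η) :
    ‖((e : ℂ) + η * Complex.I) - E‖ ≤ 2 * η := by
  have h1 : ((e : ℂ) + η * Complex.I) - E = ((e - E : ℝ) : ℂ) + η * Complex.I := by
    push_cast; ring
  rw [h1]
  refine (norm_add_le _ _).trans ?_
  rw [Complex.norm_real, norm_mul, Complex.norm_I, mul_one, Complex.norm_real, Real.norm_eq_abs,
    Real.norm_eq_abs, abs_of_nonneg ((abs_nonneg _).trans h), abs_sub_comm]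
  linarith

/-- An eigenfunction is small at a point around which the Green function decays. -/
theorem norm_eigenfunction_le {g : ℝ} {w : (Fin d → ℤ) → ℝ} {B : Finset (Fin d → ℤ)}
    {ψ : (Fin d → ℤ) → ℂ} {E : ℝ} (hψ : ∀ u ∈ B, hamApply g w B ψ u = E * ψ u)
    (hψ1 : ∀ u ∈ B, ‖ψ u‖ ≤ 1) {x : Fin d → ℤ} (hx : x ∈ B) {r : ℕ} {a e η ε : ℝ} (hη : 0 < η)
    (hηε : 4 * η ≤ ε) (he : |E - e| ≤ η)
    (hN : ¬ Near g (B.filter fun u => natDist x u ≤ r) E ε w)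
    (hG : ∀ u ∈ B.filter fun u => natDist x u ≤ r, r ≤ natDist x u →
      ‖greenExt g ((e : ℂ) + η * Complex.I) (B.filter fun u => natDist x u ≤ r) w x u‖ ≤ a)
    (ha : 0 ≤ a) : ‖ψ x‖ ≤ B.card * (3 ^ d * a + 4 * η / ε) := by
  have hε : 0 < ε := by linarith
  set S := B.filter fun u => natDist x u ≤ r with hS
  have hSB : S ⊆ B := Finset.filter_subset _ _
  have hxS : x ∈ S := Finset.mem_filter.2 ⟨hx, by rw [natDist_self]; exact Nat.zero_le _⟩
  set z : ℂ := (e : ℂ) + η * Complex.I with hz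
  have hzim : z.im ≠ 0 := by rw [hz, im_add_mul_I]; exact hη.ne'
  have hzE : ‖z - E‖ ≤ 2 * η := norm_add_mul_I_sub_le he
  -- Restricted to `S`, the eigenfunction solves an equation with two sources: the values across the
  -- boundary of `S`, and the mismatch `E - z`.
  set ρ : (Fin d → ℤ) → ℂ := fun v => ∑ u ∈ B \ S, (adj v u : ℂ) * ψ u with hρ
  have heq : ∀ v ∈ S, hamApply g w S ψ v - z * ψ v = ρ v + (E - z) * ψ v := by
    intro v hv
    have h1 := hψ v (hSB hv)
    rw [hamApply_eq _ _ _ (hSB hv), ← Finset.sum_sdiff hSB] at h1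
    rw [hamApply_eq _ _ _ hv, hρ]
    simp only
    linear_combination h1
  rw [eq_sum_greenExt hzim heq hxS]
  refine (norm_sum_le _ _).trans ?_
  have hterm : ∀ v ∈ S, ‖greenExt g z S w x v * (ρ v + (E - z) * ψ v)‖ ≤
      3 ^ d * a + 4 * η / ε := by
    intro v hv
    rw [mul_add]
    refine (norm_add_le _ _).trans (add_le_add ?_ ?_)
    · by_cases hvr : r ≤ natDist x v
      · rw [norm_mul, mul_comm]
        refine mul_le_mul ?_ (hG v hv hvr) (norm_nonneg _) (by positivity)
        refine (norm_sum_le _ _).trans (le_trans (Finset.sum_le_sum fun u hu => ?_)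
          (sum_adj_le (B \ S) v))
        rw [norm_mul, Complex.norm_real, Real.norm_eq_abs, abs_of_nonneg (adj_nonneg _ _)]
        exact mul_le_of_le_one_right (adj_nonneg _ _) (hψ1 u (Finset.sdiff_subset hu))
      -- A site closer to `x` than `r` has all its neighbours in `B` inside `S`, so only the outer
      -- layer contributes, where the Green function is small.
      · have h0 : ρ v = 0 := by
          refine Finset.sum_eq_zero fun u hu => ?_
          have huS := (Finset.mem_sdiff.1 hu).2
          by_cases hadj : adj v u = 0
          · simp [hadj]
          · exfalso
            refine huS (Finset.mem_filter.2 ⟨Finset.sdiff_subset hu, ?_⟩)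
            have h1 := natDist_le_one_of_adj hadj
            have h2 := natDist_triangle x v u
            omega
        rw [h0, mul_zero, norm_zero]
        positivity
    -- The mismatch is at most `2 * η`, against a Green function bounded by `2 / ε`.
    · rw [norm_mul, norm_mul, norm_sub_rev]
      have h1 := norm_greenExt_le_of_not_near hε hN hzim (hzE.trans (by linarith)) hxS hv
      calc _ ≤ 2 / ε * (2 * η * 1) := by
            gcongr
            exact hψ1 v (hSB hv)
        _ = 4 * η / ε := by ring
  refine (Finset.sum_le_sum hterm).trans ?_
  rw [Finset.sum_const, nsmul_eq_mul]
  have hcard : (S.card : ℝ) ≤ B.card := by exact_mod_cast Finset.card_le_card hSB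
  gcongr

theorem abs_sub_floor_mul_le (E : ℝ) {η : ℝ} (hη : 0 < η) : |E - ⌊E / η⌋ * η| ≤ η := by
  have h1 : (⌊E / η⌋ : ℝ) * η ≤ E := (le_div_iff₀ hη).1 (Int.floor_le _)
  have h2 : E < (⌊E / η⌋ + 1) * η := (div_lt_iff₀ hη).1 (Int.lt_floor_add_one _)
  rw [abs_of_nonneg (by linarith)]
  linarith

/-- The part of `B` within distance `r` of `x`. -/
def localSet (B : Finset (Fin d → ℤ)) (x : Fin d → ℤ) (r : ℕ) : Finset (Fin d → ℤ) :=
  B.filter fun u => natDist x u ≤ r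

/-- For some energy of the grid, close to the potential outside the vicinity of `x`, the Green
function around `x` fails to decay. -/
def GridResonant (g : ℝ) (B : Finset (Fin d → ℤ)) (r : ℕ) (a η : ℝ) (w : (Fin d → ℤ) → ℝ)
    (x : Fin d → ℤ) : Prop :=
  ∃ z₀ ∈ B \ localSet B x r, ∃ j : ℤ, |g * w z₀ + 2 * d - j * η| ≤ 3 ^ d + 2 ∧
    ∃ u ∈ localSet B x r, r ≤ natDist x u ∧
      a ≤ ‖greenExt g (((j * η : ℝ) : ℂ) + η * Complex.I) (localSet B x r) w x u‖

/-- The vicinities of `x` and `y` have close eigenvalues. -/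
def PairResonant (g : ℝ) (B : Finset (Fin d → ℤ)) (r : ℕ) (ε : ℝ) (w : (Fin d → ℤ) → ℝ)
    (x y : Fin d → ℤ) : Prop :=
  ∃ j : ℤ, Near g (localSet B x r) (j * ε) (2 * ε) w ∧ Near g (localSet B y r) (j * ε) (2 * ε) w

theorem disjoint_localSet {B : Finset (Fin d → ℤ)} {x y : Fin d → ℤ} {r : ℕ}
    (h : 2 * r < natDist x y) : Disjoint (localSet B x r) (localSet B y r) := by
  rw [Finset.disjoint_left]
  intro u hu hu'
  have h1 := (Finset.mem_filter.1 hu).2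
  have h2 := (Finset.mem_filter.1 hu').2
  have h3 := natDist_triangle x u y
  rw [natDist_comm u y] at h3
  omega

/-- Without resonances, an eigenfunction is small at one of two given distant points. -/
theorem norm_eigenfunction_le_or {g : ℝ} {w : (Fin d → ℤ) → ℝ} {B : Finset (Fin d → ℤ)}
    {x y : Fin d → ℤ} (hx : x ∈ B) (hy : y ∈ B) {r : ℕ} (hr : 2 * r < natDist x y)
    {a η ε : ℝ} (ha : 0 < a) (hη : 0 < η) (hηε : 4 * η ≤ ε) (hε1 : ε ≤ 1)
    (hGx : ¬ GridResonant g B r a η w x) (hGy : ¬ GridResonant g B r a η w y)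
    (hP : ¬ PairResonant g B r ε w x y) {ψ : (Fin d → ℤ) → ℂ} {E : ℝ}
    (hψ : ∀ u ∈ B, hamApply g w B ψ u = E * ψ u) (hψ1 : ∀ u ∈ B, ‖ψ u‖ ≤ 1) :
    ‖ψ x‖ ≤ B.card * (3 ^ d * a + 4 * η / ε) ∨ ‖ψ y‖ ≤ B.card * (3 ^ d * a + 4 * η / ε) := by
  have hε : 0 < ε := by linarith
  have hdisj := disjoint_localSet (B := B) hr
  -- Smallness at `v` needs two things: `E` away from the spectrum of the vicinity of `v`, and a
  -- site outside that vicinity which locates `E`. Rounding `E` to the grid moves it by `η ≤ 1`,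
  -- whence `3 ^ d + 2` in `GridResonant`.
  have key : ∀ v ∈ B, ¬ GridResonant g B r a η w v → ∀ z₀ ∈ B, z₀ ∉ localSet B v r →
      |g * w z₀ + 2 * d - E| ≤ 3 ^ d + 1 → ¬ Near g (localSet B v r) E ε w →
      ‖ψ v‖ ≤ B.card * (3 ^ d * a + 4 * η / ε) := by
    intro v hv hGv z₀ hz₀ hz₀' hE hN
    have hj := abs_sub_floor_mul_le E hη
    refine norm_eigenfunction_le hψ hψ1 hv hη hηε hj hN (fun u hu hru => ?_) ha.le
    by_contra hcon
    refine hGv ⟨z₀, Finset.mem_sdiff.2 ⟨hz₀, hz₀'⟩, ⌊E / η⌋, ?_, u, hu, hru, (not_le.1 hcon).le⟩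
    have h1 := abs_sub_le (g * w z₀ + 2 * d) E (⌊E / η⌋ * η)
    linarith
  by_cases hψx : ψ x = 0
  · left
    rw [hψx, norm_zero]
    positivity
  by_cases hNx : Near g (localSet B x r) E ε w
  · by_cases hNy : Near g (localSet B y r) E ε w
    · exfalso
      have hj := abs_sub_floor_mul_le E hε
      refine hP ⟨⌊E / ε⌋, ?_, ?_⟩
      · rw [two_mul]; exact hNx.shift hj
      · rw [two_mul]; exact hNy.shift hj
    · obtain ⟨z₀, hz₀, hE⟩ := hNx.exists_site hε1
      exact Or.inr (key y hy hGy z₀ (Finset.mem_of_mem_filter z₀ hz₀)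
        (Finset.disjoint_left.1 hdisj hz₀) hE hNy)
  · by_cases hNy : Near g (localSet B y r) E ε w
    · obtain ⟨z₀, hz₀, hE⟩ := hNy.exists_site hε1
      exact Or.inl (key x hx hGx z₀ (Finset.mem_of_mem_filter z₀ hz₀)
        (Finset.disjoint_right.1 hdisj hz₀) hE hNx)
    -- With neither vicinity resonant, the locating site comes from the eigenfunction on all of `B`;
    -- by disjointness it lies outside at least one vicinity.
    · obtain ⟨z₀, hz₀, hE⟩ := (near_of_hamApply_eq one_pos hψ hx hψx).exists_site le_rfl
      by_cases hz₀x : z₀ ∈ localSet B x r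
      · exact Or.inr (key y hy hGy z₀ hz₀ (Finset.disjoint_left.1 hdisj hz₀x) hE hNy)
      · exact Or.inl (key x hx hGx z₀ hz₀ hz₀x hE hNx)

theorem FractionalDecay.measure_gridResonant_le [IsProbabilityMeasure μ]
    (hV : ∀ x, Measurable (V x)) {τ g q : ℝ} (hD : FractionalDecay μ V τ g q)
    {B : Finset (Fin d → ℤ)} {x : Fin d → ℤ} (hx : x ∈ B) (r : ℕ) {a η : ℝ} (ha : 0 < a)
    (hη : 0 < η) :
    μ {ω | GridResonant g B r a η (fun u => V u ω) x} ≤ ENNReal.ofReal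
      ((B.card : ℝ) ^ 2 * (a ^ (-τ) * q ^ r) * (2 * (3 ^ d + 2) / η + 1)) := by
  have hq := hD.q_pos
  have hxS : x ∈ localSet B x r :=
    Finset.mem_filter.2 ⟨hx, by rw [natDist_self]; exact Nat.zero_le _⟩
  have hsub : {ω | GridResonant g B r a η (fun u => V u ω) x} ⊆
      ⋃ z₀ ∈ B \ localSet B x r, {ω | ∃ j : ℤ, |g * V z₀ ω + 2 * d - j * η| ≤ 3 ^ d + 2 ∧
        ∃ u ∈ localSet B x r, r ≤ natDist x u ∧
        a ≤ ‖greenExt g (((j * η : ℝ) : ℂ) + η * Complex.I) (localSet B x r)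
          (fun u => V u ω) x u‖} := by
    rintro ω ⟨z₀, hz₀, h⟩
    exact Set.mem_biUnion hz₀ h
  refine (measure_mono hsub).trans ((measure_biUnion_finset_le _ _).trans ?_)
  refine (Finset.sum_le_card_nsmul _ _ _ fun z₀ hz₀ => hD.measure_exists_greenExt_le hV hxS
    (Finset.mem_sdiff.1 hz₀).2 r ha hη (by positivity)).trans ?_
  rw [nsmul_eq_mul, ← ENNReal.ofReal_natCast, ← ENNReal.ofReal_mul (by positivity)]
  refine ENNReal.ofReal_le_ofReal ?_
  have h1 : ((B \ localSet B x r).card : ℝ) ≤ B.card := by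
    exact_mod_cast Finset.card_le_card Finset.sdiff_subset
  have h2 : ((localSet B x r).card : ℝ) ≤ B.card := by
    exact_mod_cast Finset.card_le_card (Finset.filter_subset _ _)
  calc _ ≤ (B.card : ℝ) * (B.card * (a ^ (-τ) * q ^ r) * (2 * (3 ^ d + 2) / η + 1)) := by gcongr
    _ = _ := by ring

theorem FractionalDecay.measure_pairResonant_le [IsProbabilityMeasure μ]
    (hV : ∀ x, Measurable (V x)) {τ g q : ℝ} (hD : FractionalDecay μ V τ g q)
    (B : Finset (Fin d → ℤ)) {x y : Fin d → ℤ} {r : ℕ} (hr : 2 * r < natDist x y) {ε : ℝ}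
    (hε : 0 < ε) :
    μ {ω | PairResonant g B r ε (fun u => V u ω) x y} ≤ ENNReal.ofReal
      ((B.card : ℝ) ^ 2 * (4 * ε * B.card) ^ τ * (B.card * (8 * B.card ^ 2 + 1))) := by
  refine (hD.measure_exists_near_le hV (disjoint_localSet (B := B) hr) hε).trans ?_
  refine ENNReal.ofReal_le_ofReal ?_
  have hτ := hD.τ_pos
  have h1 : ((localSet B x r).card : ℝ) ≤ B.card := by
    exact_mod_cast Finset.card_le_card (Finset.filter_subset _ _)
  have h2 : ((localSet B y r).card : ℝ) ≤ B.card := by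
    exact_mod_cast Finset.card_le_card (Finset.filter_subset _ _)
  gcongr

/-! ### Green functions at real energies -/

/-- Away from the spectrum the Green function is controlled by its values at complex energies. -/
theorem norm_greenExt_real_le {g : ℝ} {S : Finset (Fin d → ℤ)} {E ε η : ℝ}
    {w : (Fin d → ℤ) → ℝ} (hη : 0 < η) (hηε : 4 * η ≤ ε) (hN : ¬ Near g S E ε w)
    (hu : IsUnit (hamMatrix g w S - (E : ℂ) • (1 : Matrix S S ℂ)).det) {x y : Fin d → ℤ}
    (hx : x ∈ S) (hy : y ∈ S) :
    ‖greenExt g E S w x y‖ ≤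
      ‖greenExt g (E + η * Complex.I) S w x y‖ + S.card * (4 * η / ε ^ 2) := by
  have hε : 0 < ε := by linarith
  set z : ℂ := (E : ℂ) + η * Complex.I with hz
  have hzim : z.im ≠ 0 := by rw [hz, im_add_mul_I]; exact hη.ne'
  have hzE : ‖z - E‖ ≤ 2 * η := norm_add_mul_I_sub_le (by simpa using hη.le)
  set f : (Fin d → ℤ) → ℂ := fun u => greenExt g E S w u y with hf
  have hfeq : ∀ u ∈ S, hamApply g w S f u - E * f u = if u = y then 1 else 0 :=
    fun u hu' => hamApply_greenExt_of_isUnit hu hu' hy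
  have hf1 : ∀ u ∈ S, ‖f u‖ ≤ 1 / ε := fun u hu' =>
    norm_le_of_not_near hε hN (r := 1) (fun v hv => by
      rw [hfeq v hv]; split_ifs <;> simp) hu'
  -- The first resolvent identity, with the change of energy as a source. Both resolvents are
  -- bounded by multiples of `1 / ε`, hence the error `4 * η / ε ^ 2` per site.
  have heq : ∀ u ∈ S, hamApply g w S f u - z * f u = (if u = y then 1 else 0) + (E - z) * f u :=
    fun u hu' => by rw [← hfeq u hu']; ring
  have h1 := eq_sum_greenExt hzim heq hx
  simp only [mul_add, Finset.sum_add_distrib, mul_ite, mul_one, mul_zero] at h1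
  rw [Finset.sum_ite_eq' S y, if_pos hy] at h1
  change ‖f x‖ ≤ _
  rw [h1]
  refine (norm_add_le _ _).trans (add_le_add le_rfl ((norm_sum_le _ _).trans ?_))
  rw [← nsmul_eq_mul]
  refine Finset.sum_le_card_nsmul _ _ _ fun u hu' => ?_
  rw [norm_mul, norm_mul, norm_sub_rev]
  have h2 := norm_greenExt_le_of_not_near hε hN hzim (hzE.trans (by linarith)) hx hu'
  calc _ ≤ 2 / ε * (2 * η * (1 / ε)) := by
        gcongr
        exact hf1 u hu'
    _ = 4 * η / ε ^ 2 := by field_simp; ring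

theorem isUnit_det_of_not_near {g : ℝ} {S : Finset (Fin d → ℤ)} {E ε : ℝ}
    {w : (Fin d → ℤ) → ℝ} (hε : 0 < ε) (hN : ¬ Near g S E ε w) :
    IsUnit (hamMatrix g w S - (E : ℂ) • (1 : Matrix S S ℂ)).det := by
  rw [isUnit_iff_ne_zero]
  intro h0
  obtain ⟨v, hv0, hv⟩ := Matrix.exists_mulVec_eq_zero_iff.2 h0
  obtain ⟨i, hi⟩ := Function.ne_iff.1 hv0
  set φ : (Fin d → ℤ) → ℂ := fun u => if h : u ∈ S then v ⟨u, h⟩ else 0 with hφ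
  have hφv : (fun u : S => φ u) = v := by
    funext u
    rw [hφ]
    simp only [u.2, dif_pos]
  refine hN (near_of_hamApply_eq hε (φ := φ) (fun x hx => ?_) i.2 ?_)
  · have h1 := sub_mulVec g w S E φ ⟨x, hx⟩
    rw [hφv, hv] at h1
    exact (sub_eq_zero.1 h1.symm)
  · have h2 := congrFun hφv i
    rw [h2]
    exact hi

end MixingAnderson

/-! ### Bookkeeping of exponents and growth of the scales -/

namespace MixingAnderson

open Real

theorem le_exp_two_mul {c R : ℝ} (hc : c ≤ 7) (hR : 1 ≤ R) : c ≤ exp (2 * R) := by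
  have h1 : (2.7182818283 : ℝ) < exp 1 := exp_one_gt_d9
  have h2 : exp 2 = exp 1 * exp 1 := by rw [← exp_add]; norm_num
  have h3 : exp 2 ≤ exp (2 * R) := exp_le_exp.2 (by linarith)
  nlinarith

theorem three_pow_le_exp (d : ℕ) {R : ℝ} (hR : 1 ≤ R) : (3 : ℝ) ^ d ≤ exp (2 * d * R) := by
  refine (pow_le_pow_left₀ (by norm_num) (le_exp_two_mul (by norm_num) hR) d).trans (le_of_eq ?_)
  rw [← exp_nat_mul]
  congr 1; ring

theorem one_le_of_rpow_le {L R : ℕ} (hL : 1 ≤ L) (h : (L : ℝ) ^ (7 / 8 : ℝ) ≤ R) :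
    (1 : ℝ) ≤ R :=
  (one_le_rpow (by exact_mod_cast hL) (by norm_num)).trans h

theorem le_sq_of_rpow_le {L R : ℕ} (hL : 1 ≤ L) (h : (L : ℝ) ^ (7 / 8 : ℝ) ≤ R) :
    (L : ℝ) ≤ (R : ℝ) ^ 2 := by
  have hR := one_le_of_rpow_le hL h
  have h1 : (L : ℝ) = ((L : ℝ) ^ (7 / 8 : ℝ)) ^ (8 / 7 : ℝ) := by
    rw [← rpow_mul (by positivity)]; norm_num
  rw [h1, ← rpow_natCast]
  refine (rpow_le_rpow (by positivity) h (by norm_num)).trans ?_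
  exact rpow_le_rpow_of_exponent_le hR (by norm_num)

/-- From `L ≤ R ^ 2` and `log √R ≤ √R`. This converts decay exponential in the distance into `exp
(-p log² L)`. -/
theorem log_sq_le {L R : ℕ} (hL : 1 ≤ L) (h : (L : ℝ) ^ (7 / 8 : ℝ) ≤ R) :
    log (L : ℝ) ^ 2 ≤ 16 * R := by
  have hR := one_le_of_rpow_le hL h
  have h0 : 0 ≤ log (L : ℝ) := log_nonneg (by exact_mod_cast hL)
  have h1 : log (L : ℝ) ≤ 2 * log R := by
    refine (log_le_log (by exact_mod_cast hL) (le_sq_of_rpow_le hL h)).trans (le_of_eq ?_)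
    rw [log_pow]; norm_num
  have h2 : log (R : ℝ) = 2 * log (√R) := by
    rw [log_sqrt (by positivity)]; ring
  have h3 : log (√(R : ℝ)) ≤ √R - 1 := log_le_sub_one_of_pos (sqrt_pos.2 (by linarith))
  have h4 : log (L : ℝ) ≤ 4 * √R := by linarith
  calc log (L : ℝ) ^ 2 ≤ (4 * √R) ^ 2 := pow_le_pow_left₀ h0 h4 2
    _ = 16 * R := by rw [mul_pow, sq_sqrt (by positivity)]; norm_num

theorem side_pow_le_exp (d : ℕ) {L R : ℕ} (hL : 1 ≤ L) (h : (L : ℝ) ^ (7 / 8 : ℝ) ≤ R) :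
    (2 * (L : ℝ) + 3) ^ d ≤ exp (4 * d * R) := by
  have hR := one_le_of_rpow_le hL h
  have hL' : (1 : ℝ) ≤ L := by exact_mod_cast hL
  have h1 := le_sq_of_rpow_le hL h
  have h2 : (R : ℝ) ≤ exp R := by linarith [add_one_le_exp (R : ℝ)]
  have h3 : (R : ℝ) ^ 2 ≤ exp (2 * R) := by
    refine (pow_le_pow_left₀ (by positivity) h2 2).trans (le_of_eq ?_)
    rw [← exp_nat_mul]; norm_num
  have h4 := le_exp_two_mul (c := 5) (by norm_num) hR
  have h5 : 2 * (L : ℝ) + 3 ≤ exp (4 * R) := by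
    have h6 : exp (4 * R) = exp (2 * R) * exp (2 * (R : ℝ)) := by rw [← exp_add]; congr 1; ring
    rw [h6]
    calc 2 * (L : ℝ) + 3 ≤ 5 * (R : ℝ) ^ 2 := by linarith
      _ ≤ _ := by gcongr
  refine (pow_le_pow_left₀ (by positivity) h5 d).trans (le_of_eq ?_)
  rw [← exp_nat_mul]
  congr 1; ring

theorem card_ball_le_exp {d : ℕ} (u : Fin d → ℤ) {L R : ℕ} (hL : 1 ≤ L)
    (h : (L : ℝ) ^ (7 / 8 : ℝ) ≤ R) : ((ball u L).card : ℝ) ≤ exp (4 * d * R) := by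
  refine le_trans ?_ (side_pow_le_exp d hL h)
  rw [card_ball]
  push_cast
  gcongr
  norm_num

theorem ncard_edgeBoundary_le_exp {d : ℕ} (u : Fin d → ℤ) {L R : ℕ} (hL : 1 ≤ L)
    (h : (L : ℝ) ^ (7 / 8 : ℝ) ≤ R) : ((edgeBoundary u L).ncard : ℝ) ≤ exp (8 * d * R) := by
  have hsub : edgeBoundary u L ⊆ ((ball u L ×ˢ ball u (L + 1) : Finset _) : Set _) := by
    rintro ⟨x, y⟩ ⟨h1, -, h3⟩
    have h1' : dist x u = (L : ℝ) := h1
    simp only at h3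
    rw [Finset.mem_coe, Finset.mem_product, mem_ball_iff_natDist, mem_ball_iff_natDist]
    rw [dist_eq_natDist, Nat.cast_inj] at h1'
    have h4 := natDist_le_graphDist x y
    have h5 := natDist_triangle y x u
    rw [natDist_comm y x] at h5
    refine ⟨h1'.le, ?_⟩
    change natDist y u ≤ L + 1
    omega
  have h1 := Set.ncard_le_ncard hsub (Finset.finite_toSet _)
  rw [Set.ncard_coe_finset, Finset.card_product, card_ball, card_ball] at h1
  have h2 : ((edgeBoundary u L).ncard : ℝ) ≤ (2 * (L : ℝ) + 1) ^ d * (2 * (L : ℝ) + 3) ^ d := by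
    refine (Nat.cast_le.2 h1).trans (le_of_eq ?_)
    push_cast
    ring
  have h3 := side_pow_le_exp d hL h
  calc ((edgeBoundary u L).ncard : ℝ) ≤ (2 * (L : ℝ) + 1) ^ d * (2 * (L : ℝ) + 3) ^ d := h2
    _ ≤ (2 * (L : ℝ) + 3) ^ d * (2 * (L : ℝ) + 3) ^ d := by gcongr; norm_num
    _ ≤ exp (4 * d * R) * exp (4 * d * R) := by gcongr
    _ = exp (8 * d * R) := by rw [← exp_add]; congr 1; ring

theorem gam_le {m : ℝ} (hm : 0 ≤ m) {L : ℕ} (hL : 1 ≤ L) : gam m L ≤ 2 * m := by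
  have h1 : (L : ℝ) ^ (-(1 / 8 : ℝ)) ≤ 1 :=
    rpow_le_one_of_one_le_of_nonpos (by exact_mod_cast hL) (by norm_num)
  rw [gam]
  nlinarith

section Exponents

variable {d : ℕ} {R κ Λ p τ n : ℝ}

theorem eigenfunction_bound_le {m : ℝ} (hR : 1 ≤ R) (hκ : 2 * m + 12 * d + 4 ≤ κ)
    (hm : 0 ≤ m) (hn0 : 0 ≤ n) (hn : n ≤ exp (4 * d * R)) :
    n * (3 ^ d * exp (-κ * R) + 4 * exp (-3 * κ * R) / exp (-κ * R)) ≤ exp (-(2 * m) * R) := by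
  have hd : (0 : ℝ) ≤ d := Nat.cast_nonneg d
  have h3 := three_pow_le_exp d hR
  have h1 : exp (-3 * κ * R) / exp (-κ * R) ≤ exp (-κ * R) := by
    rw [← exp_sub]
    exact exp_le_exp.2 (by nlinarith)
  have h31 : (1 : ℝ) ≤ 3 ^ d := one_le_pow₀ (by norm_num)
  have h5 := le_exp_two_mul (c := 5) (by norm_num) hR
  calc n * (3 ^ d * exp (-κ * R) + 4 * exp (-3 * κ * R) / exp (-κ * R))
      ≤ n * ((5 * 3 ^ d) * exp (-κ * R)) := by
        refine mul_le_mul_of_nonneg_left ?_ hn0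
        rw [mul_div_assoc]
        nlinarith [exp_pos (-κ * R)]
    _ ≤ exp (4 * d * R) * ((exp (2 * R) * exp (2 * d * R)) * exp (-κ * R)) := by gcongr
    _ = exp (4 * d * R + (2 * R + 2 * d * R + -κ * R)) := by simp only [exp_add]
    _ ≤ exp (-(2 * m) * R) := exp_le_exp.2 (by nlinarith)

/-- `Λ` is chosen to balance the exponents exactly: `8 d` from the squared cardinality, `κ` from the
threshold, `3 κ` from the grid size, `2 + 2 d` from constants, and `2 + 8 d + 16 p` to be left over.
The factor `6` is the price of `r ≥ R / 6`. -/
theorem gridResonant_bound_le {r : ℕ} (hR : 1 ≤ R) (hr : R ≤ 6 * r) (hκ : 0 ≤ κ) (hτ1 : τ ≤ 1)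
    (hΛ : 6 * (4 + 18 * d + 4 * κ + 16 * p) = Λ) (hΛ0 : 0 ≤ Λ) (hn0 : 0 ≤ n)
    (hn : n ≤ exp (4 * d * R)) :
    n ^ 2 * (exp (-κ * R) ^ (-τ) * exp (-Λ) ^ r) *
      (2 * (3 ^ d + 2) / exp (-3 * κ * R) + 1) ≤ exp (-(2 + 8 * d + 16 * p) * R) := by
  have h3 := three_pow_le_exp d hR
  have h31 : (1 : ℝ) ≤ 3 ^ d := one_le_pow₀ (by norm_num)
  have h7 := le_exp_two_mul (c := 7) le_rfl hR
  have h1 : exp (-κ * R) ^ (-τ) ≤ exp (κ * R) := by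
    rw [← exp_mul]
    refine exp_le_exp.2 ?_
    have : 0 ≤ κ * R := by positivity
    nlinarith
  have h2 : exp (-Λ) ^ r ≤ exp (-(Λ / 6) * R) := by
    rw [← exp_nat_mul]
    exact exp_le_exp.2 (by nlinarith)
  have h4 : 2 * (3 ^ d + 2) / exp (-3 * κ * R) + 1 ≤ 7 * 3 ^ d * exp (3 * κ * R) := by
    have h5 : exp (-3 * κ * R) = (exp (3 * κ * R))⁻¹ := by rw [← exp_neg]; congr 1; ring
    have h6 : 1 ≤ exp (3 * κ * R) := one_le_exp (by positivity)
    rw [h5, div_inv_eq_mul]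
    nlinarith [mul_le_mul h31 h6 zero_le_one (by positivity)]
  calc _ ≤ exp (4 * d * R) ^ 2 * (exp (κ * R) * exp (-(Λ / 6) * R)) *
        (exp (2 * R) * exp (2 * d * R) * exp (3 * κ * R)) := by
        have h8 : 2 * (3 ^ d + 2) / exp (-3 * κ * R) + 1 ≤
            exp (2 * R) * exp (2 * d * R) * exp (3 * κ * R) := h4.trans (by gcongr)
        gcongr
    _ = exp ((4 * d * R + 4 * d * R) + (κ * R + -(Λ / 6) * R) +
        (2 * R + 2 * d * R + 3 * κ * R)) := by simp only [exp_add, sq]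
    _ ≤ _ := exp_le_exp.2 (by rw [← hΛ]; nlinarith)

theorem near_bound_le (hR : 1 ≤ R) (hτ0 : 0 < τ)
    (hκ : 5 + 28 * d + 16 * p + τ * (2 + 4 * d) ≤ τ * κ) (hn0 : 0 ≤ n)
    (hn : n ≤ exp (4 * d * R)) :
    n ^ 2 * (4 * exp (-κ * R) * n) ^ τ ≤ exp (-(5 + 20 * d + 16 * p) * R) := by
  have h4 := le_exp_two_mul (c := 4) (by norm_num) hR
  calc n ^ 2 * (4 * exp (-κ * R) * n) ^ τ
      ≤ exp (4 * d * R) ^ 2 * (exp (2 * R) * exp (-κ * R) * exp (4 * d * R)) ^ τ := by gcongr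
    _ = exp ((4 * d * R + 4 * d * R) + (2 * R + -κ * R + 4 * d * R) * τ) := by
        rw [← exp_add, ← exp_add, ← exp_mul, sq, ← exp_add, ← exp_add]
    _ ≤ _ := exp_le_exp.2 (by nlinarith)

/-- The count of grid energies is at most `9 n ^ 3`, which costs `3 + 12 d` of the exponent in
`near_bound_le`. -/
theorem pairResonant_bound_le (hR : 1 ≤ R) (hτ0 : 0 < τ)
    (hκ : 5 + 28 * d + 16 * p + τ * (2 + 4 * d) ≤ τ * κ) (hn1 : 1 ≤ n)
    (hn : n ≤ exp (4 * d * R)) :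
    n ^ 2 * (4 * exp (-κ * R) * n) ^ τ * (n * (8 * n ^ 2 + 1)) ≤
      exp (-(2 + 8 * d + 16 * p) * R) := by
  have h1 := near_bound_le hR hτ0 hκ (by linarith) hn
  have h9 : (9 : ℝ) ≤ exp (3 * R) := by
    have h4 := le_exp_two_mul (c := 7) le_rfl hR
    have h5 : (2 : ℝ) ≤ exp R := by linarith [add_one_le_exp R]
    have h6 : exp (3 * R) = exp (2 * R) * exp R := by rw [← exp_add]; congr 1; ring
    rw [h6]; nlinarith
  have h2 : n * (8 * n ^ 2 + 1) ≤ 9 * n ^ 3 := by nlinarith [one_le_pow₀ hn1 (n := 2)]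
  calc _ ≤ exp (-(5 + 20 * d + 16 * p) * R) * (exp (3 * R) * exp (4 * d * R) ^ 3) := by
        have h3 : n * (8 * n ^ 2 + 1) ≤ exp (3 * R) * exp (4 * d * R) ^ 3 :=
          h2.trans (by gcongr)
        gcongr
    _ = exp (-(5 + 20 * d + 16 * p) * R + (3 * R + (3 : ℕ) * (4 * d * R))) := by
        rw [← exp_nat_mul, ← exp_add, ← exp_add]
    _ = _ := by congr 1; push_cast; ring

end Exponents

/-- The logarithm grows by a factor of at least `4 / 3` per step, and starts above `1` because `L₀ ≥
3 > e`. -/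
theorem pow_le_log_scale {L₀ : ℕ} (hL₀ : 2 < L₀) (k : ℕ) :
    (4 / 3 : ℝ) ^ k ≤ log (scale L₀ k) := by
  induction k with
  | zero =>
    have h1 : (3 : ℝ) ≤ L₀ := by exact_mod_cast hL₀
    rw [pow_zero, scale, le_log_iff_exp_le (by linarith)]
    linarith [exp_one_lt_d9]
  | succ k ih =>
    have h0 : 0 < log (scale L₀ k : ℝ) := lt_of_lt_of_le (by positivity) ih
    have h1 : (0 : ℝ) < scale L₀ k := by
      rcases (Nat.cast_nonneg (α := ℝ) (scale L₀ k)).eq_or_lt with h | h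
      · rw [← h, log_zero] at h0; exact absurd h0 (lt_irrefl _)
      · exact h
    have h2 : (scale L₀ k : ℝ) ^ (4 / 3 : ℝ) ≤ scale L₀ (k + 1) := by
      rw [scale]; push_cast; exact (Nat.lt_floor_add_one _).le
    have h3 := log_le_log (by positivity) h2
    rw [log_rpow h1] at h3
    rw [pow_succ]
    linarith

theorem three_le_scale {L₀ : ℕ} (hL₀ : 2 < L₀) (k : ℕ) : 3 ≤ scale L₀ k := by
  have h1 := pow_le_log_scale hL₀ k
  have h2 : (1 : ℝ) ≤ log (scale L₀ k) := (one_le_pow₀ (by norm_num)).trans h1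
  have h3 : (0 : ℝ) < scale L₀ k := by
    rcases (Nat.cast_nonneg (α := ℝ) (scale L₀ k)).eq_or_lt with h | h
    · rw [← h, log_zero] at h2; norm_num at h2
    · exact h
  rw [le_log_iff_exp_le h3] at h2
  have h4 : (2 : ℝ) < scale L₀ k := by linarith [exp_one_gt_d9]
  exact_mod_cast h4

/-- One of the two factors `log L_k` is traded for the smaller number `(4/3)^k`. The
superexponential form of the bound comes from here. -/
theorem exp_log_sq_le_scale_rpow {L₀ : ℕ} (hL₀ : 2 < L₀) {p : ℝ} (hp : 0 < p) (k : ℕ) :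
    exp (-p * log (scale L₀ k) ^ 2) ≤ (scale L₀ k : ℝ) ^ (-(p * (1 + 1 / 3) ^ k)) := by
  have h1 := pow_le_log_scale hL₀ k
  have h2 := three_le_scale hL₀ k
  have h3 : (0 : ℝ) < scale L₀ k := by exact_mod_cast (by omega : 0 < scale L₀ k)
  rw [rpow_def_of_pos h3]
  refine exp_le_exp.2 ?_
  have h4 : (1 + 1 / 3 : ℝ) ^ k ≤ log (scale L₀ k) := by
    rw [show (1 + 1 / 3 : ℝ) = 4 / 3 by norm_num]; exact h1
  have h5 : (0 : ℝ) ≤ log (scale L₀ k) := le_trans (by positivity) h4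
  nlinarith [mul_le_mul_of_nonneg_left h4 (mul_nonneg hp.le h5)]

end MixingAnderson

/-! ### Probability estimates for balls -/

namespace MixingAnderson

open MeasureTheory
open scoped ENNReal

variable {d : ℕ}

/-- Since `3 ^ 7 > 2 ^ 8`. For `R ≥ 3` the radius `(R - 1) / 2` is positive and at least `R / 6`. -/
theorem two_lt_of_rpow_le {L R : ℕ} (hL : 3 ≤ L) (h : (L : ℝ) ^ (7 / 8 : ℝ) ≤ R) : 3 ≤ R := by
  have h1 : (2 : ℝ) < (3 : ℝ) ^ (7 / 8 : ℝ) := by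
    refine lt_of_pow_lt_pow_left₀ 8 (by positivity) ?_
    rw [← Real.rpow_natCast ((3 : ℝ) ^ (7 / 8 : ℝ)), ← Real.rpow_mul (by norm_num)]
    norm_num
  have h2 : (3 : ℝ) ^ (7 / 8 : ℝ) ≤ (L : ℝ) ^ (7 / 8 : ℝ) :=
    Real.rpow_le_rpow (by norm_num) (by exact_mod_cast hL) (by norm_num)
  have h3 : (2 : ℝ) < R := by linarith
  exact_mod_cast h3

/-- Without resonances the ball is localized. -/
theorem localized_of_not_resonant {g : ℝ} {w : (Fin d → ℤ) → ℝ} {u : Fin d → ℤ} {L : ℕ}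
    (hL : 3 ≤ L) {m κ : ℝ} (hm : 0 ≤ m) (hκ : 2 * m + 12 * d + 4 ≤ κ)
    (h : ∀ x ∈ ball u L, ∀ y ∈ ball u L, (L : ℝ) ^ (7 / 8 : ℝ) ≤ natDist x y →
      ¬ GridResonant g (ball u L) ((natDist x y - 1) / 2) (Real.exp (-κ * natDist x y))
        (Real.exp (-3 * κ * natDist x y)) w x ∧
      ¬ GridResonant g (ball u L) ((natDist x y - 1) / 2) (Real.exp (-κ * natDist x y))
        (Real.exp (-3 * κ * natDist x y)) w y ∧
      ¬ PairResonant g (ball u L) ((natDist x y - 1) / 2) (Real.exp (-κ * natDist x y)) w x y) :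
    Localized g w m u L := by
  intro E ψ hψ hnorm x y hxy
  have hL1 : 1 ≤ L := by omega
  rw [dist_eq_natDist] at hxy ⊢
  obtain ⟨h1, h2, h3⟩ := h x x.2 y y.2 hxy
  have hR3 := two_lt_of_rpow_le hL hxy
  have hR1 := one_le_of_rpow_le hL1 hxy
  have hcard := card_ball_le_exp u hL1 hxy
  set R := natDist (x : Fin d → ℤ) y with hR
  set φ : (Fin d → ℤ) → ℂ := fun v => if h : v ∈ ball u L then ψ ⟨v, h⟩ else 0 with hφ
  have hφψ : ∀ v : ball u L, φ v = ψ v := fun v => by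
    rw [hφ]
    simp only [v.2, dif_pos]
  have hφeq : ∀ v ∈ ball u L, hamApply g w (ball u L) φ v = E * φ v := by
    intro v hv
    have h4 := hamMatrix_mulVec g w (ball u L) φ ⟨v, hv⟩
    rw [show (fun y : ball u L => φ y) = ψ from funext hφψ, ← hamiltonian_eq, hψ] at h4
    rw [← h4, hφψ ⟨v, hv⟩]
    rfl
  have hφ1 : ∀ v ∈ ball u L, ‖φ v‖ ≤ 1 := by
    intro v hv
    rw [hφψ ⟨v, hv⟩]
    have h4 := Finset.single_le_sum (f := fun x => ‖ψ x‖ ^ 2) (fun i _ => by positivity)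
      (Finset.mem_univ (⟨v, hv⟩ : ball u L))
    rw [hnorm] at h4
    exact (sq_le_one_iff₀ (norm_nonneg _)).1 h4
  have hκ4 : 4 ≤ κ := by
    have hd : (0 : ℝ) ≤ d := Nat.cast_nonneg d
    linarith
  have hηε : 4 * Real.exp (-3 * κ * R) ≤ Real.exp (-κ * R) := by
    have h4 := le_exp_two_mul (c := 4) (by norm_num) hR1
    calc 4 * Real.exp (-3 * κ * R) ≤ Real.exp (2 * R) * Real.exp (-3 * κ * R) := by gcongr
      _ = Real.exp (2 * R + -3 * κ * R) := by rw [Real.exp_add]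
      _ ≤ _ := Real.exp_le_exp.2 (by nlinarith)
  -- The radius `(R - 1) / 2` is the largest `r` with `2 * r < R`, the condition for disjoint
  -- vicinities. Smallness at one point is enough for the product, since the other factor is at most
  -- one.
  have hor := norm_eigenfunction_le_or x.2 y.2 (show 2 * ((R - 1) / 2) < R by omega)
    (Real.exp_pos _) (Real.exp_pos _) hηε (Real.exp_le_one_iff.2 (by nlinarith)) h1 h2 h3 hφeq hφ1
  have hb := eigenfunction_bound_le hR1 hκ hm (Nat.cast_nonneg _) hcard
  have hfin : Real.exp (-(2 * m) * R) ≤ Real.exp (-gam m L * R) := by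
    refine Real.exp_le_exp.2 ?_
    have := gam_le hm hL1
    nlinarith
  have hx1 := hφ1 x x.2
  have hy1 := hφ1 y y.2
  rw [hφψ] at hx1 hy1
  rw [hφψ, hφψ] at hor
  refine le_trans ?_ hfin
  rcases hor with hx | hy
  · exact (mul_le_of_le_one_right (norm_nonneg _) hy1).trans (hx.trans hb)
  · exact (mul_le_of_le_one_left (norm_nonneg _) hx1).trans (hy.trans hb)

/-- The exponent `2 + 8 d + 16 p` pays for the constant, for a union over pairs of sites, and for `p
log² L ≤ 16 p R`. -/
theorem const_mul_exp_le {L R : ℕ} (hL : 1 ≤ L) (h : (L : ℝ) ^ (7 / 8 : ℝ) ≤ R) (u : Fin d → ℤ)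
    {c p : ℝ} (hc : c ≤ 7) (hp : 0 ≤ p) :
    c * Real.exp (-(2 + 8 * d + 16 * p) * R) ≤
      Real.exp (-p * Real.log L ^ 2) / ((ball u L).card : ℝ) ^ 2 := by
  have hR := one_le_of_rpow_le hL h
  have hcard0 : 0 < ((ball u L).card : ℝ) := by
    rw [card_ball]; positivity
  have h1 := le_exp_two_mul hc hR
  have h2 := card_ball_le_exp u hL h
  have h3 := log_sq_le hL h
  rw [le_div_iff₀ (by positivity)]
  calc c * Real.exp (-(2 + 8 * d + 16 * p) * R) * ((ball u L).card : ℝ) ^ 2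
      ≤ Real.exp (2 * R) * Real.exp (-(2 + 8 * d + 16 * p) * R) *
        Real.exp (4 * d * R) ^ 2 := by gcongr
    _ = Real.exp (2 * R + -(2 + 8 * d + 16 * p) * R + (4 * d * R + 4 * d * R)) := by
        simp only [Real.exp_add, sq]
    _ ≤ _ := Real.exp_le_exp.2 (by nlinarith)

variable {Ω : Type*} [MeasurableSpace Ω] {μ : Measure Ω} {V : (Fin d → ℤ) → Ω → ℝ}

theorem measure_biUnion_pairs_le (B : Finset (Fin d → ℤ)) (P : (Fin d → ℤ) → (Fin d → ℤ) → Prop)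
    (F : (Fin d → ℤ) → (Fin d → ℤ) → Set Ω) {T : ℝ} (hT : 0 ≤ T)
    (h : ∀ x ∈ B, ∀ y ∈ B, P x y → μ (F x y) ≤ ENNReal.ofReal (T / (B.card : ℝ) ^ 2)) :
    μ {ω | ∃ x ∈ B, ∃ y ∈ B, P x y ∧ ω ∈ F x y} ≤ ENNReal.ofReal T := by
  classical
  have hsub : {ω | ∃ x ∈ B, ∃ y ∈ B, P x y ∧ ω ∈ F x y} ⊆
      ⋃ q ∈ (B ×ˢ B).filter fun q => P q.1 q.2, F q.1 q.2 := by
    rintro ω ⟨x, hx, y, hy, hP, hω⟩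
    exact Set.mem_biUnion (show (x, y) ∈ ((B ×ˢ B).filter fun q => P q.1 q.2 : Finset _) from
      Finset.mem_filter.2 ⟨Finset.mem_product.2 ⟨hx, hy⟩, hP⟩) hω
  refine (measure_mono hsub).trans ((measure_biUnion_finset_le _ _).trans ?_)
  refine (Finset.sum_le_card_nsmul _ _ (ENNReal.ofReal (T / (B.card : ℝ) ^ 2))
    fun q hq => ?_).trans ?_
  · have h1 := Finset.mem_filter.1 hq
    have h2 := Finset.mem_product.1 h1.1
    exact h q.1 h2.1 q.2 h2.2 h1.2
  · rw [nsmul_eq_mul, ← ENNReal.ofReal_natCast, ← ENNReal.ofReal_mul (by positivity)]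
    refine ENNReal.ofReal_le_ofReal ?_
    have h1 : ((((B ×ˢ B).filter fun q => P q.1 q.2).card : ℕ) : ℝ) ≤ (B.card : ℝ) ^ 2 := by
      have h2 := Finset.card_filter_le (B ×ˢ B) fun q => P q.1 q.2
      rw [Finset.card_product, ← sq] at h2
      exact_mod_cast h2
    calc _ ≤ (B.card : ℝ) ^ 2 * (T / (B.card : ℝ) ^ 2) := by gcongr
      _ ≤ T := by
        by_cases h0 : (B.card : ℝ) ^ 2 = 0
        · rw [h0, zero_mul]; exact hT
        · exact (mul_div_cancel₀ T h0).le

variable [IsProbabilityMeasure μ] {τ g κ Λ p m : ℝ}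

/-- For each pair of distant sites three resonance events must be excluded, two of grid type and one
of pair type; each has probability at most `exp (-(2 + 8 d + 16 p) R)`. -/
theorem FractionalDecay.measure_not_localized_le (hV : ∀ x, Measurable (V x))
    (hD : FractionalDecay μ V τ g (Real.exp (-Λ))) (hm : 0 ≤ m) (hp : 0 ≤ p)
    (hκ : 2 * m + 12 * d + 4 ≤ κ) (hκ' : 5 + 28 * d + 16 * p + τ * (2 + 4 * d) ≤ τ * κ)
    (hΛ : 6 * (4 + 18 * d + 4 * κ + 16 * p) = Λ) (u : Fin d → ℤ) {L : ℕ} (hL : 3 ≤ L) :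
    μ {ω | ¬ Localized g (fun x => V x ω) m u L} ≤
      ENNReal.ofReal (Real.exp (-p * Real.log L ^ 2)) := by
  have hL1 : 1 ≤ L := by omega
  have hd : (0 : ℝ) ≤ d := Nat.cast_nonneg d
  have hκ0 : 0 ≤ κ := by linarith
  set G : (Fin d → ℤ) → (Fin d → ℤ) → (Fin d → ℤ) → Set Ω := fun x y v =>
    {ω | GridResonant g (ball u L) ((natDist x y - 1) / 2) (Real.exp (-κ * natDist x y))
      (Real.exp (-3 * κ * natDist x y)) (fun a => V a ω) v} with hG
  set P : (Fin d → ℤ) → (Fin d → ℤ) → Set Ω := fun x y =>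
    {ω | PairResonant g (ball u L) ((natDist x y - 1) / 2) (Real.exp (-κ * natDist x y))
      (fun a => V a ω) x y} with hP
  have hsub : {ω | ¬ Localized g (fun x => V x ω) m u L} ⊆
      {ω | ∃ x ∈ ball u L, ∃ y ∈ ball u L, (L : ℝ) ^ (7 / 8 : ℝ) ≤ natDist x y ∧
        ω ∈ (G x y x ∪ G x y y) ∪ P x y} := by
    intro ω hω
    by_contra hcon
    refine hω (localized_of_not_resonant hL hm hκ fun x hx y hy hxy => ?_)
    have h1 : ω ∉ (G x y x ∪ G x y y) ∪ P x y := fun h => hcon ⟨x, hx, y, hy, hxy, h⟩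
    rw [Set.mem_union, Set.mem_union, not_or, not_or] at h1
    exact ⟨h1.1.1, h1.1.2, h1.2⟩
  refine (measure_mono hsub).trans (measure_biUnion_pairs_le (ball u L) _ _ (Real.exp_pos _).le
    fun x hx y hy hxy => ?_)
  have hR3 := two_lt_of_rpow_le hL hxy
  have hR1 := one_le_of_rpow_le hL1 hxy
  have hcard := card_ball_le_exp u hL1 hxy
  have hcard1 : (1 : ℝ) ≤ (ball u L).card := by
    exact_mod_cast Finset.card_pos.2 ⟨x, hx⟩
  have hfinal := const_mul_exp_le hL1 hxy u (c := 3) (by norm_num) hp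
  set R := natDist x y with hR
  have hr : (R : ℝ) ≤ 6 * ((R - 1) / 2 : ℕ) := by
    have h : R ≤ 6 * ((R - 1) / 2) := by omega
    exact_mod_cast h
  have hgrid : ∀ v ∈ ball u L, μ (G x y v) ≤
      ENNReal.ofReal (Real.exp (-(2 + 8 * d + 16 * p) * R)) := fun v hv =>
    (hD.measure_gridResonant_le hV hv _ (Real.exp_pos _) (Real.exp_pos _)).trans
      (ENNReal.ofReal_le_ofReal (gridResonant_bound_le hR1 hr hκ0 hD.τ_le_one hΛ
        (by rw [← hΛ]; positivity) (by linarith) hcard))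
  have hpair : μ (P x y) ≤ ENNReal.ofReal (Real.exp (-(2 + 8 * d + 16 * p) * R)) :=
    (hD.measure_pairResonant_le hV (ball u L) (show 2 * ((R - 1) / 2) < R by omega)
      (Real.exp_pos _)).trans
      (ENNReal.ofReal_le_ofReal (pairResonant_bound_le hR1 hD.τ_pos hκ' hcard1 hcard))
  refine le_trans ?_ (ENNReal.ofReal_le_ofReal hfinal)
  refine (measure_union_le _ _).trans ((add_le_add ((measure_union_le _ _).trans
    (add_le_add (hgrid x hx) (hgrid y hy))) hpair).trans (le_of_eq ?_))
  rw [← ENNReal.ofReal_add (by positivity) (by positivity),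
    ← ENNReal.ofReal_add (by positivity) (by positivity)]
  congr 1; ring

theorem nonSingular_of_not_near {β E : ℝ} {w : (Fin d → ℤ) → ℝ} {u : Fin d → ℤ} {L : ℕ}
    (hL : 3 ≤ L) (hm : 0 ≤ m) (hκ : 2 * m + 12 * d + 4 ≤ κ)
    (hN : ¬ Near g (ball u L) E (Real.exp (-κ * L)) w)
    (hG : ∀ x ∈ ball u L, ∀ y ∈ ball u L, (L : ℝ) ^ (7 / 8 : ℝ) ≤ natDist x y →
      ‖greenExt g ((E : ℂ) + (Real.exp (-5 * κ * L) : ℝ) * Complex.I) (ball u L) w x y‖ ≤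
        Real.exp (-κ * natDist x y)) : NonSingular β g w E m u L := by
  have hL1 : 1 ≤ L := by omega
  have hLr : (3 : ℝ) ≤ L := by exact_mod_cast hL
  have hd : (0 : ℝ) ≤ d := Nat.cast_nonneg d
  have hκ4 : 4 ≤ κ := by linarith
  have hu := isUnit_det_of_not_near (Real.exp_pos _) hN
  have hshift : shifted g w u L E =
      hamMatrix g w (ball u L) - (E : ℂ) • (1 : Matrix (ball u L) (ball u L) ℂ) := by
    rw [shifted, hamiltonian_eq]
  refine ⟨by rw [hshift]; exact (Matrix.isUnit_iff_isUnit_det _).2 hu, fun x y hxy => ?_⟩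
  rw [dist_eq_natDist] at hxy ⊢
  have hR1 := one_le_of_rpow_le hL1 hxy
  have hcard := card_ball_le_exp u hL1 hxy
  have hedge := ncard_edgeBoundary_le_exp u hL1 hxy
  have hGxy := hG x x.2 y y.2 hxy
  have hR2L : (natDist (x : Fin d → ℤ) y : ℝ) ≤ 2 * L := by
    have h1 := natDist_triangle (x : Fin d → ℤ) u y
    have h2 := mem_ball_iff_natDist.1 x.2
    have h3 := mem_ball_iff_natDist.1 y.2
    rw [natDist_comm] at h3
    have h4 : natDist (x : Fin d → ℤ) y ≤ 2 * L := by omega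
    exact_mod_cast h4
  set R := natDist (x : Fin d → ℤ) y with hR
  have hgreen : green g w u L E x y = greenExt g E (ball u L) w x y := by
    rw [greenExt, dif_pos ⟨x.2, y.2⟩, green, hshift]
  have hηε : 4 * Real.exp (-5 * κ * L) ≤ Real.exp (-κ * L) := by
    have h4 := le_exp_two_mul (c := 4) (by norm_num) (show (1 : ℝ) ≤ L by linarith)
    calc 4 * Real.exp (-5 * κ * L) ≤ Real.exp (2 * L) * Real.exp (-5 * κ * L) := by gcongr
      _ = Real.exp (2 * L + -5 * κ * L) := by rw [Real.exp_add]
      _ ≤ _ := Real.exp_le_exp.2 (by nlinarith)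
  have h1 := norm_greenExt_real_le (Real.exp_pos _) hηε hN hu x.2 y.2
  -- The choice `η = exp (-5 κ L)`, `ε = exp (-κ L)` leaves `exp (-3 κ L)`, enough because `R ≤ 2 *
  -- L`.
  have h2 : 4 * Real.exp (-5 * κ * L) / Real.exp (-κ * L) ^ 2 ≤ 4 * Real.exp (-κ * R) := by
    rw [mul_div_assoc, sq, ← Real.exp_add, ← Real.exp_sub]
    refine mul_le_mul_of_nonneg_left (Real.exp_le_exp.2 ?_) (by norm_num)
    nlinarith
  have h5 := le_exp_two_mul (c := 5) (by norm_num) hR1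
  have h6 : (1 : ℝ) ≤ Real.exp (4 * d * R) := Real.one_le_exp (by positivity)
  have h7 : ‖green g w u L E x y‖ ≤
      Real.exp (2 * R) * Real.exp (4 * d * R) * Real.exp (-κ * R) := by
    rw [hgreen]
    calc _ ≤ Real.exp (-κ * R) + ((ball u L).card : ℝ) * (4 * Real.exp (-κ * R)) := by
          refine h1.trans (add_le_add hGxy ?_)
          exact mul_le_mul_of_nonneg_left h2 (Nat.cast_nonneg _)
      _ ≤ Real.exp (-κ * R) + Real.exp (4 * d * R) * (4 * Real.exp (-κ * R)) := by gcongr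
      _ ≤ 5 * Real.exp (4 * d * R) * Real.exp (-κ * R) := by
          nlinarith [Real.exp_pos (-κ * R)]
      _ ≤ _ := by gcongr
  calc _ ≤ Real.exp (8 * d * R) *
        (Real.exp (2 * R) * Real.exp (4 * d * R) * Real.exp (-κ * R)) := by gcongr
    _ = Real.exp (8 * d * R + (2 * R + 4 * d * R + -κ * R)) := by simp only [Real.exp_add]
    _ ≤ _ := by
        refine Real.exp_le_exp.2 ?_
        have h8 := gam_le hm hL1
        have h9 : 0 ≤ (L : ℝ) ^ β := by positivity
        nlinarith

/-- At a fixed energy no grid is needed: half of the probability goes to the Wegner estimate for the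
whole ball, half to failure of decay at one complex energy. -/
theorem FractionalDecay.measure_not_nonSingular_le (hV : ∀ x, Measurable (V x))
    (hD : FractionalDecay μ V τ g (Real.exp (-Λ))) (hm : 0 ≤ m) (hp : 0 ≤ p)
    (hκ : 2 * m + 12 * d + 4 ≤ κ) (hκ' : 5 + 28 * d + 16 * p + τ * (2 + 4 * d) ≤ τ * κ)
    (hΛ : 6 * (4 + 18 * d + 4 * κ + 16 * p) = Λ) (β E : ℝ) (u : Fin d → ℤ) {L : ℕ}
    (hL : 3 ≤ L) :
    μ {ω | ¬ NonSingular β g (fun x => V x ω) E m u L} ≤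
      ENNReal.ofReal (Real.exp (-p * Real.log L ^ 2)) := by
  have hL1 : 1 ≤ L := by omega
  have hL1' : (1 : ℝ) ≤ L := by exact_mod_cast hL1
  have hd : (0 : ℝ) ≤ d := Nat.cast_nonneg d
  have hκ0 : 0 ≤ κ := by linarith
  have hLL : (L : ℝ) ^ (7 / 8 : ℝ) ≤ L := by
    conv_rhs => rw [← Real.rpow_one (L : ℝ)]
    exact Real.rpow_le_rpow_of_exponent_le hL1' (by norm_num)
  have hcard1 : (1 : ℝ) ≤ (ball u L).card := by
    rw [card_ball]
    exact_mod_cast Nat.one_le_pow _ _ (by omega)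
  set T : ℝ := Real.exp (-p * Real.log L ^ 2) with hT
  have hT0 : 0 < T := Real.exp_pos _
  set z : ℂ := (E : ℂ) + (Real.exp (-5 * κ * L) : ℝ) * Complex.I with hz
  set F : (Fin d → ℤ) → (Fin d → ℤ) → Set Ω := fun x y =>
    {ω | (fun a => V a ω) ∈ (Set.univ : Set ((Fin d → ℤ) → ℝ)) ∧ Real.exp (-κ * natDist x y) ≤
      ‖greenExt g z (ball u L) (fun a => V a ω) x y‖} with hF
  set N : Set Ω := {ω | (fun a => V a ω) ∈ (Set.univ : Set ((Fin d → ℤ) → ℝ)) ∧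
    Near g (ball u L) E (Real.exp (-κ * L)) fun a => V a ω} with hNdef
  have hsub : {ω | ¬ NonSingular β g (fun x => V x ω) E m u L} ⊆
      N ∪ {ω | ∃ x ∈ ball u L, ∃ y ∈ ball u L, (L : ℝ) ^ (7 / 8 : ℝ) ≤ natDist x y ∧
        ω ∈ F x y} := by
    intro ω hω
    by_contra hcon
    rw [Set.mem_union, not_or] at hcon
    refine hω (nonSingular_of_not_near hL hm hκ (fun h => hcon.1 ⟨Set.mem_univ _, h⟩)
      fun x hx y hy hxy => ?_)
    by_contra h1
    exact hcon.2 ⟨x, hx, y, hy, hxy, Set.mem_univ _, (not_le.1 h1).le⟩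
  have hNle : μ N ≤ ENNReal.ofReal (T / 2) := by
    have h1 := hD.measure_near_le hV (OutsideEvent.univ (ball u L)) E (Real.exp_pos (-κ * L))
    rw [show {ω : Ω | (fun a => V a ω) ∈ (Set.univ : Set ((Fin d → ℤ) → ℝ))} = Set.univ from
      Set.eq_univ_of_forall fun ω => Set.mem_univ _, measure_univ, mul_one] at h1
    refine h1.trans (ENNReal.ofReal_le_ofReal ?_)
    have h2 := const_mul_exp_le hL1 hLL u (c := 2) (by norm_num) hp
    have h3 := near_bound_le hL1' hD.τ_pos hκ' (by linarith) (card_ball_le_exp u hL1 hLL)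
    have h4 : T / ((ball u L).card : ℝ) ^ 2 ≤ T := div_le_self hT0.le (one_le_pow₀ hcard1)
    have h5 : Real.exp (-(5 + 20 * d + 16 * p) * L) ≤ Real.exp (-(2 + 8 * d + 16 * p) * L) :=
      Real.exp_le_exp.2 (by nlinarith)
    have h6 : ((ball u L).card : ℝ) ^ 2 * (2 * Real.exp (-κ * L) * (ball u L).card) ^ τ ≤
        ((ball u L).card : ℝ) ^ 2 * (4 * Real.exp (-κ * L) * (ball u L).card) ^ τ := by
      have := hD.τ_pos
      gcongr
      norm_num
    linarith
  have hFle : μ {ω | ∃ x ∈ ball u L, ∃ y ∈ ball u L, (L : ℝ) ^ (7 / 8 : ℝ) ≤ natDist x y ∧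
      ω ∈ F x y} ≤ ENNReal.ofReal (T / 2) := by
    refine measure_biUnion_pairs_le (ball u L) _ F (by positivity) fun x hx y hy hxy => ?_
    have hzim : z.im ≠ 0 := by rw [hz, im_add_mul_I]; exact (Real.exp_pos _).ne'
    have h1 := hD.measure_le_norm_greenExt hV hzim hx hy (OutsideEvent.univ (ball u L)) le_rfl
      (Real.exp_pos (-κ * natDist x y))
    rw [show {ω : Ω | (fun a => V a ω) ∈ (Set.univ : Set ((Fin d → ℤ) → ℝ))} = Set.univ from
      Set.eq_univ_of_forall fun ω => Set.mem_univ _, measure_univ, mul_one] at h1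
    refine h1.trans (ENNReal.ofReal_le_ofReal ?_)
    have h2 := const_mul_exp_le hL1 hxy u (c := 2) (by norm_num) hp
    have hR1 := one_le_of_rpow_le hL1 hxy
    have h3 : Real.exp (-κ * natDist x y) ^ (-τ) * Real.exp (-Λ) ^ natDist x y ≤
        Real.exp (-(2 + 8 * d + 16 * p) * natDist x y) := by
      rw [← Real.exp_mul, ← Real.exp_nat_mul, ← Real.exp_add]
      refine Real.exp_le_exp.2 ?_
      have h4 : τ * (κ * natDist x y) ≤ 1 * (κ * natDist x y) :=
        mul_le_mul_of_nonneg_right hD.τ_le_one (by positivity)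
      rw [← hΛ]
      nlinarith [mul_nonneg hκ0 (Nat.cast_nonneg (α := ℝ) (natDist x y)),
        mul_nonneg hd (Nat.cast_nonneg (α := ℝ) (natDist x y)),
        mul_nonneg hp (Nat.cast_nonneg (α := ℝ) (natDist x y))]
    have h5 : T / 2 / ((ball u L).card : ℝ) ^ 2 = T / ((ball u L).card : ℝ) ^ 2 / 2 := by ring
    rw [h5]
    linarith
  refine (measure_mono hsub).trans ((measure_union_le _ _).trans
    ((add_le_add hNle hFle).trans (le_of_eq ?_)))
  rw [← ENNReal.ofReal_add (by positivity) (by positivity), add_halves]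

/-- Strong disorder implies fractional moment decay. -/
theorem exists_fractionalDecay (hV : ∀ x, Measurable (V x)) {C s : ℝ} (hs : 0 < s)
    (hH : HolderWith μ V C s) (Λ : ℝ → ℝ) (hΛ : ∀ τ, 0 < τ → 0 ≤ Λ τ) :
    ∃ τ g₀ : ℝ, 0 < τ ∧ ∀ g : ℝ, g₀ ≤ |g| → FractionalDecay μ V τ g (Real.exp (-Λ τ)) := by
  set τ := min s 1 / 2 with hτ
  have hmin : 0 < min s 1 := lt_min hs one_pos
  have hτ0 : 0 < τ := by positivity
  have hτs : τ < s := by linarith [min_le_left s 1]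
  have hτ1 : τ ≤ 1 := by linarith [min_le_right s 1]
  obtain ⟨K, hK0, hK⟩ := exists_lintegral_inv_rpow_le hV hH hτ0 hτs
  set M : ℝ := 3 ^ d * K * Real.exp (Λ τ) with hM
  have hM0 : 0 < M := by positivity
  -- This threshold solves `3 ^ d * K * g₀ ^ (-τ) = exp (-Λ τ)`. The rate may depend on `τ`, which
  -- is fixed beforehand by `s` alone.
  refine ⟨τ, M ^ (1 / τ), hτ0, fun g hg => ?_⟩
  have hg0 : 0 < |g| := lt_of_lt_of_le (by positivity) hg
  refine ⟨hτ0, hτ1, Real.exp_pos _, Real.exp_le_one_iff.2 (by linarith [hΛ τ hτ0]),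
    ENNReal.ofReal (K * |g| ^ (-τ)), hK g (abs_pos.1 hg0), ?_⟩
  have h1 : M ≤ |g| ^ τ := by
    have h2 := Real.rpow_le_rpow (by positivity) hg hτ0.le
    rwa [← Real.rpow_mul hM0.le, one_div, inv_mul_cancel₀ hτ0.ne', Real.rpow_one] at h2
  have h3 : (3 : ℝ≥0∞) ^ d = ENNReal.ofReal (3 ^ d) := by
    rw [ENNReal.ofReal_pow (by norm_num)]; norm_num
  rw [h3, ← ENNReal.ofReal_mul (by positivity)]
  refine ENNReal.ofReal_le_ofReal ?_
  rw [Real.rpow_neg hg0.le, Real.exp_neg, ← mul_assoc, ← div_eq_mul_inv,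
    div_le_iff₀ (by positivity), ← div_eq_inv_mul, le_div_iff₀ (Real.exp_pos _)]
  exact h1

end MixingAnderson

/-! ### The theorem -/

theorem mainTheorem6 {d : ℕ} {Ω : Type*} [MeasurableSpace Ω]
    (μ : MeasureTheory.Measure Ω) [MeasureTheory.IsProbabilityMeasure μ]
    (V : (Fin d → ℤ) → Ω → ℝ) (hV : ∀ x, Measurable (V x))
    (hHolder : MixingAnderson.UniformlyHolder μ V)
    (hMixing : MixingAnderson.StronglyMixing μ V)
    (β : ℝ) (hβ0 : 0 < β) (hβ1 : β < 1)
    (m : ℝ) (hm : 0 < m) (p : ℝ) (hp : 0 < p) (L₀ : ℕ) (hL₀ : 2 < L₀) :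
    ∃ g₀ b : ℝ, 0 < b ∧ ∀ g : ℝ, g₀ ≤ |g| → ∀ k : ℕ,
      (∀ u : Fin d → ℤ,
        μ.real {ω | ¬ MixingAnderson.Localized g (fun x => V x ω) m u
            (MixingAnderson.scale L₀ k)} ≤
          (MixingAnderson.scale L₀ k : ℝ) ^ (-(p * (1 + b) ^ k))) ∧
      (∀ (E : ℝ) (u v : Fin d → ℤ),
        MixingAnderson.Distant (MixingAnderson.scale L₀ k) u v →
        μ.real {ω |
            ¬ MixingAnderson.NonSingular β g (fun x => V x ω) E m u
                (MixingAnderson.scale L₀ k) ∧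
            ¬ MixingAnderson.NonSingular β g (fun x => V x ω) E m v
                (MixingAnderson.scale L₀ k)} ≤
          (MixingAnderson.scale L₀ k : ℝ) ^ (-(p * (1 + b) ^ k))) := by
  obtain ⟨C, s, hs, hH⟩ := hHolder
  -- The first term lets the gain `τ * κ` of the Wegner estimate beat its losses; the second gives
  -- decay at rate `2 * m ≥ gam m L` after combinatorial factors.
  set κ : ℝ → ℝ := fun τ => (5 + 28 * d + 16 * p) / τ + (2 * m + 12 * d + 4) with hκ
  have hκ0 : ∀ τ, 0 < τ → 2 * m + 12 * d + 4 ≤ κ τ := fun τ hτ =>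
    le_add_of_nonneg_left (by positivity)
  obtain ⟨τ, g₀, hτ, hg₀⟩ := MixingAnderson.exists_fractionalDecay hV hs hH
    (fun τ => 6 * (4 + 18 * d + 4 * κ τ + 16 * p)) (fun τ hτ => by
      have h : 0 ≤ κ τ := le_trans (by positivity) (hκ0 τ hτ)
      positivity)
  have hκ' : 5 + 28 * d + 16 * p + τ * (2 + 4 * d) ≤ τ * κ τ := by
    have h1 : τ * κ τ = 5 + 28 * d + 16 * p + τ * (2 * m + 12 * d + 4) := by
      rw [hκ]; field_simp
    rw [h1]
    have hd : (0 : ℝ) ≤ d := Nat.cast_nonneg d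
    have h2 := mul_le_mul_of_nonneg_left
      (show (2 + 4 * d : ℝ) ≤ 2 * m + 12 * d + 4 by linarith) hτ.le
    linarith
  refine ⟨g₀, 1 / 3, by norm_num, fun g hg k => ?_⟩
  have hscale := MixingAnderson.three_le_scale hL₀ k
  have hle := MixingAnderson.exp_log_sq_le_scale_rpow hL₀ hp k
  refine ⟨fun u => ?_, fun E u v _ => ?_⟩
  · refine le_trans (ENNReal.toReal_le_of_le_ofReal (Real.exp_pos _).le ?_) hle
    exact (hg₀ g hg).measure_not_localized_le hV hm.le hp.le (hκ0 τ hτ) hκ' rfl u hscale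
  · refine le_trans (ENNReal.toReal_le_of_le_ofReal (Real.exp_pos _).le ?_) hle
    -- Singularity of the first ball alone already has the required small probability.
    exact (MeasureTheory.measure_mono fun ω hω => hω.1).trans
      ((hg₀ g hg).measure_not_nonSingular_le hV hm.le hp.le (hκ0 τ hτ) hκ' rfl β E u hscale)
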